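/- Let $F$ be the distribution function of a probability law on $\mathbb R$. Assume that $F$ is $C^2$ and strictly increasing, that $F$ and $1-F$ are strictly log-concave, and that $F'$ and $F''$ are bounded. For a price $v$ and an expected valuation $u$ let $g(v,u)=v\,(1-F(v-u))$, and let $J(u)=\arg\max_{v}g(v,u)$. Let $B\in\mathbb R$. Then there is a constant $C_s$, depending only on $F$ and $B$, such that the following holds. Let $d\ge 1$, let $B_1,B_2$ satisfy $B_1B_2=B$, let $\mathbb H\subseteq\{\theta\in\mathbb R^d:\|\theta\|_2\le B_1\}$ be convex, let $D\subseteq\{x\in\mathbb R^d:\|x\|_2\le B_2\}$, and assume $0\le x^\top\theta\le B$ for all $x\in D$, $\theta\in\mathbb H$. Let $\theta^*\in\mathbb H$. Let the features $x_0,x_1,x_2,\dots$ be i.i.d. from an arbitrary distribution $\mathbb D$ concentrated on $D$, and let the noise variables $N_0,N_1,N_2,\dots$ be i.i.d. with distribution function $F$, independent of the features. In round $t$ the seller sees $x_t$, posts a price $v_t$ and observes only $\mathbf 1_t=\mathbf 1(v_t\le x_t^\top\theta^*+N_t)$. Write $$\ell_t(\theta)=-\mathbf 1_t\log\bigl(1-F(v_t-x_t^\top\theta)\bigr)-(1-\mathbf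 1_t)\log F(v_t-x_t^\top\theta).$$ The seller, who knows $F$ and $\mathbb H$ but neither $\theta^*$ nor $\mathbb D$, runs epoch-based max-likelihood pricing (EMLP). In an initialization round $t=0$ the seller posts any (possibly random) nonnegative price $v_0$, and takes $\hat\theta_1\in\arg\min_{\theta\in\mathbb H}\ell_0(\theta)$. For $k=1,2,\dots$, epoch $k$ consists of the $\tau_k=2^{k-1}$ rounds $t=2^{k-1},\dots,2^k-1$; in these rounds the seller posts $v_t=J(x_t^\top\hat\theta_k)$, and after the epoch takes $\hat\theta_{k+1}\in\arg\min_{\theta\in\mathbb H}\frac1{\tau_k}\sum_{t=2^{k-1}}^{2^k-1}\ell_t(\theta)$. Each minimizer is assumed to exist and to be chosen as a measurable function of the past records and of internal randomness of the seller that is independent of all features and noise; ties may be broken arbitrarily. The initial price is likewise a measurable function of $x_0$ and this internal randomness. Let $Reg_t=\max_{v}g(v,x_t^\top\theta^*)-g(v_t,x_t^\top\theta^*)$. Then for every $T\ge 2$ the regret of the initialization round together with the $T$ rounds that follow it satisfies $$\mathbb E\Bigl[\sum_{t=0}^{T}Reg_t\Bigr]\le 2\,C_s\,d\,\log T ,$$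 and every round $t$ of every epoch $k\ge1$ satisfies $\mathbb E[Reg_t]\le C_s\,d/\tau_k$. In particular these expectations are finite, and $C_s$ does not depend on $d$, $T$, $\theta^*$, $\mathbb H$ or the feature distribution $\mathbb D$. -/

import Mathlib

open MeasureTheory ProbabilityTheory

namespace FeaturePricing

/-- Feature (and parameter) vectors: `ℝ^d` with the Euclidean norm. -/
abbrev Vec (d : ℕ) : Type := EuclideanSpace ℝ (Fin d)

/-- The record of one round: feature, proposed price, and whether the sale took place. -/
abbrev Obs (d : ℕ) : Type := Vec d × ℝ × Bool

/-- Assumption on the law `ν` of the noise, whose distribution function is `F = cdf ν`: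
`F` is `C²` and strictly increasing, `F` and `1 - F` are strictly log-concave,
and `F'`, `F''` are bounded. -/
structure IsAdmissibleNoise (ν : Measure ℝ) : Prop where
  contDiff : ContDiff ℝ 2 (fun w => cdf ν w)
  strictMono : StrictMono (fun w => cdf ν w)
  logConcave_cdf : StrictConcaveOn ℝ Set.univ (fun w => Real.log (cdf ν w))
  logConcave_tail : StrictConcaveOn ℝ Set.univ (fun w => Real.log (1 - cdf ν w))
  bounded_deriv : ∃ M : ℝ, ∀ w, |deriv (fun z => cdf ν z) w| ≤ M
  bounded_deriv2 : ∃ M : ℝ, ∀ w, |deriv (deriv (fun z => cdf ν z)) w| ≤ M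

/-- Expected reward `g(v, u) = v (1 - F(v - u))` of price `v` at expected valuation `u`. -/
noncomputable def expReward (ν : Measure ℝ) (v u : ℝ) : ℝ := v * (1 - cdf ν (v - u))

/-- The greedy price `J(u) = argmax_v g(v, u)`. For admissible noise the maximizer exists and is
unique, so the value is determined. -/
noncomputable def greedyPrice (ν : Measure ℝ) (u : ℝ) : ℝ :=
  Classical.epsilon (fun v : ℝ => ∀ w : ℝ, expReward ν w u ≤ expReward ν v u)

/-- Negative log-likelihood of the parameter `θ` given the record of one round. -/
noncomputable def negLogLik {d : ℕ} (ν : Measure ℝ) (o : Obs d) (θ : Vec d) : ℝ :=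
  if o.2.2 = true then -Real.log (1 - cdf ν (o.2.1 - inner ℝ o.1 θ))
  else -Real.log (cdf ν (o.2.1 - inner ℝ o.1 θ))

/-- A pricing policy: in round `t` it sees its internal random seed, the current feature and the
records of rounds `0, …, t - 1`. -/
abbrev Policy (S : Type*) (d : ℕ) : Type _ := (t : ℕ) → S → Vec d → (Fin t → Obs d) → ℝ

/-- The records of rounds `0, …, t - 1` when policy `A` (with seed `s`) faces features `x` and
noise `N` under the true parameter `θ`; the product is sold iff price `≤ ⟪x t, θ⟫ + N t`. -/
noncomputable def transcript {S : Type*} {d : ℕ} (A : Policy S d) (θ : Vec d) (s : S)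
    (x : ℕ → Vec d) (N : ℕ → ℝ) : (t : ℕ) → (Fin t → Obs d)
  | 0 => Fin.elim0
  | t + 1 =>
    let h := transcript A θ s x N t
    let v := A t s (x t) h
    Fin.snoc (α := fun _ => Obs d) h (x t, v, decide (v ≤ inner ℝ (x t) θ + N t))

/-- Regret of round `t`: `max_v g(v, ⟪x t, θ⟫) - g(v_t, ⟪x t, θ⟫)`. -/
noncomputable def roundRegret {S : Type*} {d : ℕ} (ν : Measure ℝ) (A : Policy S d) (θ : Vec d)
    (s : S) (x : ℕ → Vec d) (N : ℕ → ℝ) (t : ℕ) : ℝ :=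
  (⨆ v : ℝ, expReward ν v (inner ℝ (x t) θ)) -
    expReward ν (A t s (x t) (transcript A θ s x N t)) (inner ℝ (x t) θ)

/-- Cumulative regret of the initialization round `0` and of the rounds `1, …, T`. -/
noncomputable def regret {S : Type*} {d : ℕ} (ν : Measure ℝ) (A : Policy S d) (θ : Vec d)
    (s : S) (x : ℕ → Vec d) (N : ℕ → ℝ) (T : ℕ) : ℝ :=
  ∑ t ∈ Finset.range (T + 1), roundRegret ν A θ s x N t

/-- Epoch `e = 0, 1, 2, …` (of length `2 ^ e`) consists of the rounds `2 ^ e ≤ t < 2 ^ (e + 1)`.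
Before it starts, the records of rounds `0, …, 2 ^ e - 1` are available; the block used for
estimation is the preceding epoch `2 ^ (e - 1), …, 2 ^ e - 1` if `e ≥ 1`, and the initialization
round `0` if `e = 0`. In both cases these are the rounds `i < 2 ^ e` with `2 ^ e / 2 ≤ i`
(integer division). -/
def block (e : ℕ) : Finset (Fin (2 ^ e)) := Finset.univ.filter (fun i => 2 ^ e / 2 ≤ (i : ℕ))

/-- Average negative log-likelihood over the estimation block. -/
noncomputable def empLoss {d : ℕ} (ν : Measure ℝ) (e : ℕ) (h : Fin (2 ^ e) → Obs d)
    (θ : Vec d) : ℝ :=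
  ((block e).card : ℝ)⁻¹ * ∑ i ∈ block e, negLogLik ν (h i) θ

/-- `est e` computes the parameter estimate used in epoch `e` from the records of all earlier
rounds (and possibly the seed, to break ties): measurably, and always returning a minimizer over
`H` of the average negative log-likelihood of the estimation block. -/
structure IsMaxLikelihood {S : Type*} [MeasurableSpace S] {d : ℕ} (ν : Measure ℝ)
    (H D : Set (Vec d)) (est : (e : ℕ) → S → (Fin (2 ^ e) → Obs d) → Vec d) : Prop where
  measurable : ∀ e, Measurable (fun p : S × (Fin (2 ^ e) → Obs d) => est e p.1 p.2)
  mem : ∀ e s h, (∀ i, (h i).1 ∈ D) → est e s h ∈ H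
  isMinOn : ∀ e s h, (∀ i, (h i).1 ∈ D) → IsMinOn (empLoss ν e h) H (est e s h)

/-- Epoch-based max-likelihood pricing: the price of round `0` is `init`, and every round
`t ≥ 1`, belonging to epoch `e = ⌊log₂ t⌋`, uses the greedy price for the estimate computed from
the records of rounds `0, …, 2 ^ e - 1`. -/
noncomputable def emlp {S : Type*} {d : ℕ} (ν : Measure ℝ) (init : S → Vec d → ℝ)
    (est : (e : ℕ) → S → (Fin (2 ^ e) → Obs d) → Vec d) : Policy S d :=
  fun t s z h =>
    if ht : t = 0 then init s z
    else greedyPrice ν (inner ℝ z (est (Nat.log 2 t) s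
      (fun i => h (Fin.castLE (Nat.pow_log_le_self 2 ht) i))))

/-- The random environment: features `x t` i.i.d. with law `𝔻`, noise `N t` i.i.d. with law `ν`,
noise independent of features, and the seller's seed `ξ` independent of all of them. -/
structure IsEnvironment {Ω S : Type*} [MeasurableSpace Ω] [MeasurableSpace S] {d : ℕ}
    (P : Measure Ω) (𝔻 : Measure (Vec d)) (ν : Measure ℝ)
    (x : ℕ → Ω → Vec d) (N : ℕ → Ω → ℝ) (ξ : Ω → S) : Prop where
  measurable_feature : ∀ t, Measurable (x t)
  measurable_noise : ∀ t, Measurable (N t)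
  measurable_seed : Measurable ξ
  law_feature : ∀ t, P.map (x t) = 𝔻
  law_noise : ∀ t, P.map (N t) = ν
  indep_rounds : iIndepFun (fun t ω => (x t ω, N t ω)) P
  indep_noise : ∀ t, IndepFun (x t) (N t) P
  indep_seed : IndepFun ξ (fun ω t => (x t ω, N t ω)) P

end FeaturePricing

/-! Two facts multiply: regret is quadratic in the prediction error, and the mean squared prediction
error after n rounds is of order d/n.

Quadratic regret. With m = (1 - F)/F', log-concavity of 1 - F makes m antitone, and the first-order
condition reads J(u) = m(J(u) - u). Hence J is monotone and 1-Lipschitz. Since the v-derivative of g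
vanishes at the optimal price and is Lipschitz near it, pricing for u instead of u₀ costs at most a
constant times (u - u₀)² (`exists_quadratic_regret`).

Estimation. Given the seed and all rounds before an epoch, every price of the epoch is the greedy
price for one fixed parameter, so its n records are i.i.d. The mean excess log-loss of θ, given x,
is a relative entropy of two Bernoulli laws. It dominates a multiple of ⟨x, θ - θ*⟩², because F' is
bounded below on the compact range of relevant arguments (`exists_negLogLik_bounds`). The curvature
is thus measured in the prediction error itself, so no lower bound on the covariance of the features
is needed and the constant does not depend on 𝔻.

Fast rate. Half of the curvature serves as a negative quadratic offset in the empirical process.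
After symmetrization and contraction, the offset process is linear on a subspace of dimension at
most d. In orthonormal coordinates each coordinate contributes K² s²/(2c), where s is a Rademacher
sum with mean square 1, so the total is O(d) for every sample size (`sum_signs_linear_offset`,
`integral_iSup_offset_le`). Dividing by n gives the rate (`integral_erm_le`). The argument works in
expectation throughout and needs no concentration inequality.

Summation. A round after an epoch is independent of the estimate computed from it, so its regret is
O(d/2^e) in epoch e. An epoch therefore costs O(d), and there are about log T epochs. Round 0 and
epoch 0 are bounded trivially. -/

namespace FeaturePricing

/-! ### Regularity of the noise law and of the greedy price -/

namespace IsAdmissibleNoise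

variable {ν : Measure ℝ}

theorem differentiable (hν : IsAdmissibleNoise ν) : Differentiable ℝ (fun w => cdf ν w) :=
  hν.contDiff.differentiable (by norm_num)

theorem hasDerivAt (hν : IsAdmissibleNoise ν) (w : ℝ) :
    HasDerivAt (fun z => cdf ν z) (deriv (fun z => cdf ν z) w) w :=
  (hν.differentiable w).hasDerivAt

theorem continuous (hν : IsAdmissibleNoise ν) : Continuous (fun w => cdf ν w) :=
  hν.contDiff.continuous

theorem cdf_pos (hν : IsAdmissibleNoise ν) (w : ℝ) : 0 < cdf ν w :=
  (cdf_nonneg ν (w - 1)).trans_lt (hν.strictMono (sub_one_lt w))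

theorem cdf_lt_one (hν : IsAdmissibleNoise ν) (w : ℝ) : cdf ν w < 1 :=
  (hν.strictMono (lt_add_one w)).trans_le (cdf_le_one ν (w + 1))

theorem hasDerivAt_log_cdf (hν : IsAdmissibleNoise ν) (w : ℝ) :
    HasDerivAt (fun z => Real.log (cdf ν z)) (deriv (fun z => cdf ν z) w / cdf ν w) w :=
  (hν.hasDerivAt w).log (hν.cdf_pos w).ne'

theorem hasDerivAt_log_tail (hν : IsAdmissibleNoise ν) (w : ℝ) :
    HasDerivAt (fun z => Real.log (1 - cdf ν z))
      (-(deriv (fun z => cdf ν z) w) / (1 - cdf ν w)) w :=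
  ((hν.hasDerivAt w).const_sub 1).log (sub_pos.2 (hν.cdf_lt_one w)).ne'

/-- Strict monotonicity alone allows critical points. Concavity of log F excludes them: the
derivative of log F at w is at least its secant slope on [w, w + 1], which is positive. -/
theorem deriv_pos (hν : IsAdmissibleNoise ν) (w : ℝ) : 0 < deriv (fun z => cdf ν z) w := by
  have h := hν.logConcave_cdf.concaveOn.slope_le_of_hasDerivAt (Set.mem_univ w)
    (Set.mem_univ (w + 1)) (lt_add_one w) (hν.hasDerivAt_log_cdf w)
  have h2 : 0 < slope (fun z => Real.log (cdf ν z)) w (w + 1) := by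
    have := Real.log_lt_log (hν.cdf_pos w) (hν.strictMono (lt_add_one w))
    simp only [slope_def_field, add_sub_cancel_left, div_one]
    linarith
  have h3 := h2.trans_le h
  exact (div_pos_iff_of_pos_right (hν.cdf_pos w)).1 h3

theorem continuous_deriv (hν : IsAdmissibleNoise ν) : Continuous (deriv (fun z => cdf ν z)) :=
  hν.contDiff.continuous_deriv (by norm_num)

theorem differentiable_deriv (hν : IsAdmissibleNoise ν) :
    Differentiable ℝ (deriv (fun z => cdf ν z)) := by
  have h : ContDiff ℝ (1 + 1) (fun w => cdf ν w) := by simpa [one_add_one_eq_two] using hν.contDiff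
  exact (contDiff_succ_iff_deriv.1 h).2.2.differentiable (by norm_num)

/-- The inverse hazard rate `(1 - F) / F'` is antitone. -/
theorem antitone_invHazard (hν : IsAdmissibleNoise ν) :
    Antitone (fun w => (1 - cdf ν w) / deriv (fun z => cdf ν z) w) := by
  intro a b hab
  -- The derivative of log (1 - F) is minus the hazard rate F'/(1 - F), so concavity makes the
  -- hazard rate monotone and its inverse antitone.
  have h := hν.logConcave_tail.concaveOn.antitoneOn_deriv
    (fun w _ => (hν.hasDerivAt_log_tail w).differentiableAt) (Set.mem_univ a) (Set.mem_univ b) hab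
  rw [(hν.hasDerivAt_log_tail a).deriv, (hν.hasDerivAt_log_tail b).deriv] at h
  have ha := hν.deriv_pos a
  have ha' := sub_pos.2 (hν.cdf_lt_one a)
  have hb := hν.deriv_pos b
  have hb' := sub_pos.2 (hν.cdf_lt_one b)
  rw [div_le_div_iff₀ hb' ha'] at h
  change _ / _ ≤ _ / _
  rw [div_le_div_iff₀ hb ha]
  linarith

theorem hasDerivAt_expReward (hν : IsAdmissibleNoise ν) (v u : ℝ) :
    HasDerivAt (fun v => expReward ν v u)
      (1 - cdf ν (v - u) - v * deriv (fun z => cdf ν z) (v - u)) v := by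
  have h := (hasDerivAt_id v).mul (((hν.hasDerivAt (v - u)).comp_sub_const v u).const_sub 1)
  refine h.congr_deriv ?_
  simp only [id]
  ring

/-- With w = v - u, the v-derivative of g factors as F'(w) (m(w) - v). Since m is antitone, m(w) - w
crosses the level u, and there g turns from increasing to decreasing. -/
theorem exists_maximizer (hν : IsAdmissibleNoise ν) (u : ℝ) :
    ∃ v, ∀ w, expReward ν w u ≤ expReward ν v u := by
  set m : ℝ → ℝ := fun w => (1 - cdf ν w) / deriv (fun z => cdf ν z) w with hm
  have hmc : Continuous m := (continuous_const.sub hν.continuous).div hν.continuous_deriv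
    fun w => (hν.deriv_pos w).ne'
  have hanti := hν.antitone_invHazard
  -- Intermediate values: on either side of 0, m(w) is compared with m(0), so moving by m(0) - u in
  -- the appropriate direction suffices.
  obtain ⟨w₀, hw₀⟩ : ∃ w, m w - w = u := by
    have h1 : m (max 0 (m 0 - u)) - max 0 (m 0 - u) ≤ u := by
      have := hanti (le_max_left 0 (m 0 - u))
      have h3 := le_max_right 0 (m 0 - u)
      simp only at this
      linarith
    have h2 : u ≤ m (min 0 (m 0 - u)) - min 0 (m 0 - u) := by
      have := hanti (min_le_left 0 (m 0 - u))
      have h3 := min_le_right 0 (m 0 - u)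
      simp only at this
      linarith
    exact mem_range_of_exists_le_of_exists_ge (hmc.sub continuous_id) ⟨_, h1⟩ ⟨_, h2⟩
  have hfac : ∀ v, 1 - cdf ν (v - u) - v * deriv (fun z => cdf ν z) (v - u)
      = deriv (fun z => cdf ν z) (v - u) * (m (v - u) - v) := by
    intro v
    have := (hν.deriv_pos (v - u)).ne'
    simp only [hm]
    field_simp
  have hc : Continuous (fun v => expReward ν v u) :=
    continuous_iff_continuousAt.2 fun v => (hν.hasDerivAt_expReward v u).continuousAt
  refine ⟨w₀ + u, fun w => ?_⟩
  rcases le_total w (w₀ + u) with h | h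
  · refine monotoneOn_of_deriv_nonneg (convex_Iic (w₀ + u)) hc.continuousOn
      (fun v _ => (hν.hasDerivAt_expReward v u).differentiableAt.differentiableWithinAt) ?_
      (Set.mem_Iic.2 h) (Set.mem_Iic.2 le_rfl) h
    intro v hv
    rw [interior_Iic, Set.mem_Iio] at hv
    rw [(hν.hasDerivAt_expReward v u).deriv, hfac]
    refine mul_nonneg (hν.deriv_pos _).le ?_
    have : m w₀ ≤ m (v - u) := hanti (by linarith)
    linarith
  · refine antitoneOn_of_deriv_nonpos (convex_Ici (w₀ + u)) hc.continuousOn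
      (fun v _ => (hν.hasDerivAt_expReward v u).differentiableAt.differentiableWithinAt) ?_
      (Set.mem_Ici.2 le_rfl) (Set.mem_Ici.2 h) h
    intro v hv
    rw [interior_Ici, Set.mem_Ioi] at hv
    rw [(hν.hasDerivAt_expReward v u).deriv, hfac]
    refine mul_nonpos_of_nonneg_of_nonpos (hν.deriv_pos _).le ?_
    have : m (v - u) ≤ m w₀ := hanti (by linarith)
    linarith

theorem expReward_le_greedyPrice (hν : IsAdmissibleNoise ν) (w u : ℝ) :
    expReward ν w u ≤ expReward ν (greedyPrice ν u) u :=
  Classical.epsilon_spec (hν.exists_maximizer u) w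

theorem iSup_expReward (hν : IsAdmissibleNoise ν) (u : ℝ) :
    ⨆ v, expReward ν v u = expReward ν (greedyPrice ν u) u :=
  le_antisymm (ciSup_le fun w => hν.expReward_le_greedyPrice w u)
    (le_ciSup (f := fun v => expReward ν v u)
      ⟨_, Set.forall_mem_range.2 fun w => hν.expReward_le_greedyPrice w u⟩ _)

theorem firstOrder (hν : IsAdmissibleNoise ν) (u : ℝ) :
    1 - cdf ν (greedyPrice ν u - u)
      - greedyPrice ν u * deriv (fun z => cdf ν z) (greedyPrice ν u - u) = 0 := by
  rw [← (hν.hasDerivAt_expReward _ u).deriv]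
  exact IsLocalMax.deriv_eq_zero (Filter.Eventually.of_forall
    fun w => hν.expReward_le_greedyPrice w u)

theorem greedyPrice_eq (hν : IsAdmissibleNoise ν) (u : ℝ) :
    greedyPrice ν u = (1 - cdf ν (greedyPrice ν u - u)) /
      deriv (fun z => cdf ν z) (greedyPrice ν u - u) := by
  rw [eq_div_iff (hν.deriv_pos _).ne']
  linarith [hν.firstOrder u]

theorem greedyPrice_pos (hν : IsAdmissibleNoise ν) (u : ℝ) : 0 < greedyPrice ν u := by
  rw [hν.greedyPrice_eq u]
  exact div_pos (sub_pos.2 (hν.cdf_lt_one _)) (hν.deriv_pos _)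

/-- Both halves follow from J(u) = m(J(u) - u) with m antitone. If J(u) - u increased from a to b,
then J would not increase, a contradiction; so J(u) - u is antitone, and applying m shows that J is
monotone. -/
theorem greedyPrice_mono_lipschitz (hν : IsAdmissibleNoise ν) {a b : ℝ} (hab : a ≤ b) :
    greedyPrice ν a ≤ greedyPrice ν b ∧ greedyPrice ν b ≤ greedyPrice ν a + (b - a) := by
  have hw : greedyPrice ν b - b ≤ greedyPrice ν a - a := by
    by_contra h
    have h2 := hν.antitone_invHazard (not_le.1 h).le
    simp only [← hν.greedyPrice_eq] at h2
    linarith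
  have h2 := hν.antitone_invHazard hw
  simp only [← hν.greedyPrice_eq] at h2
  exact ⟨h2, by linarith⟩

theorem abs_greedyPrice_sub_le (hν : IsAdmissibleNoise ν) (a b : ℝ) :
    |greedyPrice ν a - greedyPrice ν b| ≤ |a - b| := by
  rcases le_total a b with h | h
  · obtain ⟨h1, h2⟩ := hν.greedyPrice_mono_lipschitz h
    rw [abs_sub_comm, abs_sub_comm a, abs_of_nonneg (sub_nonneg.2 h1),
      abs_of_nonneg (sub_nonneg.2 h)]
    linarith
  · obtain ⟨h1, h2⟩ := hν.greedyPrice_mono_lipschitz h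
    rw [abs_of_nonneg (sub_nonneg.2 h1), abs_of_nonneg (sub_nonneg.2 h)]
    linarith

theorem measurable_greedyPrice (hν : IsAdmissibleNoise ν) : Measurable (greedyPrice ν) :=
  (LipschitzWith.of_dist_le_mul (K := 1) fun a b => by
    simpa [Real.dist_eq] using hν.abs_greedyPrice_sub_le a b).continuous.measurable

theorem measurable_expReward (hν : IsAdmissibleNoise ν) :
    Measurable (fun p : ℝ × ℝ => expReward ν p.1 p.2) := by
  have h : Continuous (fun p : ℝ × ℝ => cdf ν (p.1 - p.2)) :=
    hν.continuous.comp (continuous_fst.sub continuous_snd)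
  exact (continuous_fst.mul (continuous_const.sub h)).measurable

theorem greedyPrice_mem_Icc (hν : IsAdmissibleNoise ν) {B u : ℝ} (h0 : 0 ≤ u) (hB : u ≤ B) :
    greedyPrice ν u ∈ Set.Icc 0 (greedyPrice ν 0 + B) := by
  obtain ⟨-, h2⟩ := hν.greedyPrice_mono_lipschitz h0
  exact ⟨(hν.greedyPrice_pos u).le, by linarith⟩

/-- Posting the greedy price for `u` instead of the one for `u₀` costs `O((u - u₀) ^ 2)`. -/
theorem exists_quadratic_regret (hν : IsAdmissibleNoise ν) (B : ℝ) :
    ∃ C : ℝ, 0 ≤ C ∧ ∀ u₀ u : ℝ, 0 ≤ u₀ → u₀ ≤ B → 0 ≤ u → u ≤ B →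
      expReward ν (greedyPrice ν u₀) u₀ - expReward ν (greedyPrice ν u) u₀
        ≤ C * (u - u₀) ^ 2 := by
  obtain ⟨M₁, hM₁⟩ := hν.bounded_deriv
  obtain ⟨M₂, hM₂⟩ := hν.bounded_deriv2
  have hM₁0 : 0 ≤ M₁ := (abs_nonneg _).trans (hM₁ 0)
  have hM₂0 : 0 ≤ M₂ := (abs_nonneg _).trans (hM₂ 0)
  set R := |greedyPrice ν 0 + B| with hR
  have hF : ∀ a b, |cdf ν a - cdf ν b| ≤ M₁ * |a - b| := fun a b =>
    Convex.norm_image_sub_le_of_norm_deriv_le (s := Set.univ) (f := fun w => cdf ν w)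
      (fun w _ => hν.differentiable w) (fun w _ => hM₁ w) convex_univ (Set.mem_univ b)
      (Set.mem_univ a)
  have hf : ∀ a b, |deriv (fun z => cdf ν z) a - deriv (fun z => cdf ν z) b| ≤ M₂ * |a - b| :=
    fun a b => Convex.norm_image_sub_le_of_norm_deriv_le (s := Set.univ)
      (f := deriv (fun z => cdf ν z)) (fun w _ => hν.differentiable_deriv w) (fun w _ => hM₂ w)
      convex_univ (Set.mem_univ b) (Set.mem_univ a)
  refine ⟨2 * M₁ + R * M₂, by positivity, fun u₀ u h1 h2 h3 h4 => ?_⟩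
  set v₀ := greedyPrice ν u₀ with hv₀
  set v := greedyPrice ν u with hv
  have hv₀m := hν.greedyPrice_mem_Icc h1 h2
  have hvm := hν.greedyPrice_mem_Icc h3 h4
  have hvv : |v - v₀| ≤ |u - u₀| := hν.abs_greedyPrice_sub_le u u₀
  have hder : ∀ z ∈ Set.uIcc v v₀, ‖deriv (fun v => expReward ν v u₀) z‖
      ≤ (2 * M₁ + R * M₂) * |u - u₀| := by
    intro z hz
    have hzv : |z - v₀| ≤ |u - u₀| := by
      refine le_trans ?_ hvv
      rw [Set.uIcc_comm] at hz
      exact Set.abs_sub_left_of_mem_uIcc hz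
    have hzR : |v₀| ≤ R := by
      rw [abs_of_nonneg hv₀m.1]; exact hv₀m.2.trans (le_abs_self _)
    have hfz : |deriv (fun z => cdf ν z) (z - u₀)| ≤ M₁ := hM₁ _
    rw [(hν.hasDerivAt_expReward z u₀).deriv, Real.norm_eq_abs]
    have e1 := hν.firstOrder u₀
    rw [← hv₀] at e1
    -- Subtracting the first-order condition at v₀ turns the derivative of the reward into
    -- differences. The three terms contribute M₁, M₁ and R M₂ to the constant.
    have e2 : 1 - cdf ν (z - u₀) - z * deriv (fun z => cdf ν z) (z - u₀)
        = -(cdf ν (z - u₀) - cdf ν (v₀ - u₀)) - (z - v₀) * deriv (fun z => cdf ν z) (z - u₀)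
          - v₀ * (deriv (fun z => cdf ν z) (z - u₀) - deriv (fun z => cdf ν z) (v₀ - u₀)) := by
      linarith
    rw [e2]
    have a1 := hF (z - u₀) (v₀ - u₀)
    have a2 := hf (z - u₀) (v₀ - u₀)
    rw [sub_sub_sub_cancel_right] at a1 a2
    have b1 : |(z - v₀) * deriv (fun z => cdf ν z) (z - u₀)| ≤ |z - v₀| * M₁ := by
      rw [abs_mul]; gcongr
    have b2 : |v₀ * (deriv (fun z => cdf ν z) (z - u₀) - deriv (fun z => cdf ν z) (v₀ - u₀))|
        ≤ R * (M₂ * |z - v₀|) := by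
      rw [abs_mul]; gcongr
    calc _ ≤ M₁ * |z - v₀| + |z - v₀| * M₁ + R * (M₂ * |z - v₀|) := by
          refine (abs_sub _ _).trans (add_le_add ((abs_sub _ _).trans (add_le_add ?_ b1)) b2)
          rwa [abs_neg]
      _ = (2 * M₁ + R * M₂) * |z - v₀| := by ring
      _ ≤ _ := by gcongr
  -- Between v and v₀ the slope is O(|u - u₀|), and the segment has length at most |u - u₀|; this
  -- yields the square.
  have h := Convex.norm_image_sub_le_of_norm_deriv_le (f := fun v => expReward ν v u₀)
    (fun z _ => (hν.hasDerivAt_expReward z u₀).differentiableAt) hder (convex_uIcc v v₀)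
    Set.left_mem_uIcc Set.right_mem_uIcc
  refine (le_abs_self _).trans (h.trans ?_)
  rw [Real.norm_eq_abs, abs_sub_comm v₀, mul_assoc, ← sq_abs (u - u₀), sq]
  gcongr

/-- On a bounded range the log-likelihoods are Lipschitz and `F` has a Lipschitz inverse. -/
theorem exists_lipschitz (hν : IsAdmissibleNoise ν) {a b : ℝ} (hab : a ≤ b) :
    ∃ L c : ℝ, 0 ≤ L ∧ 0 < c ∧ ∀ w ∈ Set.Icc a b, ∀ w' ∈ Set.Icc a b,
      |Real.log (cdf ν w) - Real.log (cdf ν w')| ≤ L * |w - w'| ∧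
      |Real.log (1 - cdf ν w) - Real.log (1 - cdf ν w')| ≤ L * |w - w'| ∧
      c * |w - w'| ≤ |cdf ν w - cdf ν w'| := by
  have hcont1 : Continuous (fun w => deriv (fun z => cdf ν z) w / cdf ν w) :=
    hν.continuous_deriv.div hν.continuous fun w => (hν.cdf_pos w).ne'
  have hcont2 : Continuous (fun w => -(deriv (fun z => cdf ν z) w) / (1 - cdf ν w)) :=
    hν.continuous_deriv.neg.div (continuous_const.sub hν.continuous)
      fun w => (sub_pos.2 (hν.cdf_lt_one w)).ne'
  obtain ⟨L₁, hL₁⟩ := isCompact_Icc.exists_bound_of_continuousOn (s := Set.Icc a b)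
    hcont1.continuousOn
  obtain ⟨L₂, hL₂⟩ := isCompact_Icc.exists_bound_of_continuousOn (s := Set.Icc a b)
    hcont2.continuousOn
  -- The inverse-Lipschitz constant is the minimum of F' on the interval, positive by `deriv_pos`.
  obtain ⟨w₀, -, hw₀⟩ := isCompact_Icc.exists_isMinOn (Set.nonempty_Icc.2 hab)
    hν.continuous_deriv.continuousOn
  have hL₁0 : 0 ≤ L₁ := (norm_nonneg _).trans (hL₁ a (Set.left_mem_Icc.2 hab))
  refine ⟨max L₁ L₂, deriv (fun z => cdf ν z) w₀, hL₁0.trans (le_max_left _ _), hν.deriv_pos w₀,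
    fun w hw w' hw' => ⟨?_, ?_, ?_⟩⟩
  · have h := Convex.norm_image_sub_le_of_norm_hasDerivWithin_le
      (fun z _ => (hν.hasDerivAt_log_cdf z).hasDerivWithinAt) hL₁ (convex_Icc a b) hw' hw
    exact h.trans (by gcongr; exacts [le_max_left _ _, le_rfl])
  · have h := Convex.norm_image_sub_le_of_norm_hasDerivWithin_le
      (fun z _ => (hν.hasDerivAt_log_tail z).hasDerivWithinAt) hL₂ (convex_Icc a b) hw' hw
    exact h.trans (by gcongr; exacts [le_max_right _ _, le_rfl])
  · have key : ∀ x ∈ Set.Icc a b, ∀ y ∈ Set.Icc a b, x ≤ y →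
        deriv (fun z => cdf ν z) w₀ * |x - y| ≤ |cdf ν x - cdf ν y| := by
      intro x hx y hy hxy
      have h := (convex_Icc a b).mul_sub_le_image_sub_of_le_deriv hν.continuous.continuousOn
        hν.differentiable.differentiableOn (fun z hz => hw₀ (interior_subset hz)) x hx y hy hxy
      rw [abs_sub_comm, abs_of_nonneg (sub_nonneg.2 hxy), abs_sub_comm]
      exact h.trans (le_abs_self _)
    rcases le_total w w' with h | h
    · exact key w hw w' hw' h
    · rw [abs_sub_comm, abs_sub_comm (cdf ν w)]
      exact key w' hw' w hw h

/-- The maximal expected reward is bounded on bounded ranges of the valuation. -/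
theorem expReward_greedyPrice_le (hν : IsAdmissibleNoise ν) {B u : ℝ} (h0 : 0 ≤ u)
    (hB : u ≤ B) : expReward ν (greedyPrice ν u) u ≤ greedyPrice ν 0 + B := by
  have h := hν.greedyPrice_mem_Icc h0 hB
  have h2 := hν.cdf_pos (greedyPrice ν u - u)
  unfold expReward
  nlinarith [h.1, h.2]

theorem expReward_nonneg (hν : IsAdmissibleNoise ν) {v : ℝ} (hv : 0 ≤ v) (u : ℝ) :
    0 ≤ expReward ν v u :=
  mul_nonneg hv (sub_pos.2 (hν.cdf_lt_one _)).le

/-- A sale occurs on a closed half-line of noise values, whereas F(w) also counts the point w.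
Continuity of F rules out an atom there. -/
theorem measureReal_Ici [IsProbabilityMeasure ν] (hν : IsAdmissibleNoise ν) (w : ℝ) :
    ν.real (Set.Ici w) = 1 - cdf ν w := by
  have h : ν {w} = 0 := by
    rw [← measure_cdf ν, StieltjesFunction.measure_singleton]
    have : Function.leftLim (cdf ν) w = cdf ν w :=
      (hν.continuous.continuousWithinAt (s := Set.Iic w) (x := w)).leftLim_eq
    simp [this]
  have h2 : ν.real (Set.Iio w) = cdf ν w := by
    rw [cdf_eq_real, ← Set.Iio_union_right, measureReal_union (by simp) (by simp)]
    simp [Measure.real, h]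
  rw [← Set.compl_Iio, probReal_compl_eq_one_sub measurableSet_Iio, h2]

end IsAdmissibleNoise

/-! ### Relative entropy of Bernoulli laws -/

/-- A lower bound for the relative entropy of two Bernoulli laws. -/
theorem bernoulli_entropy_ge {p q : ℝ} (hp : 0 < p) (hp' : p < 1) (hq : 0 < q) (hq' : q < 1) :
    (p - q) ^ 2 / 2 ≤ p * (Real.log p - Real.log q)
      + (1 - p) * (Real.log (1 - p) - Real.log (1 - q)) := by
  -- A Hellinger-type bound: with s = √a and r = √b, log (r/s) ≤ r/s - 1 gives a (log a - log b) ≥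
  -- (s - r)² + (a - b), and (a - b)² ≤ 4 (s - r)². The linear terms cancel when the bounds for p, q
  -- and 1 - p, 1 - q are added.
  have key : ∀ a b : ℝ, 0 < a → a < 1 → 0 < b → b < 1 →
      (a - b) ^ 2 / 4 + (a - b) ≤ a * (Real.log a - Real.log b) := by
    intro a b ha ha' hb hb'
    obtain ⟨s, hs, rfl⟩ : ∃ s, 0 < s ∧ s ^ 2 = a := ⟨√a, by positivity, Real.sq_sqrt ha.le⟩
    obtain ⟨r, hr, rfl⟩ : ∃ r, 0 < r ∧ r ^ 2 = b := ⟨√b, by positivity, Real.sq_sqrt hb.le⟩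
    have hs1 : s < 1 := by nlinarith
    have hr1 : r < 1 := by nlinarith
    have h := Real.log_le_sub_one_of_pos (div_pos hr hs)
    rw [Real.log_div hr.ne' hs.ne'] at h
    have h2 : s ^ 2 * (Real.log r - Real.log s) ≤ s ^ 2 * (r / s - 1) := by gcongr
    have h3 : s ^ 2 * (r / s - 1) = s * r - s ^ 2 := by field_simp
    rw [Real.log_pow, Real.log_pow]
    push_cast
    have h4 : (s + r) ^ 2 ≤ 4 := by nlinarith
    have h5 : (s ^ 2 - r ^ 2) ^ 2 / 4 ≤ (s - r) ^ 2 := by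
      have : (s ^ 2 - r ^ 2) ^ 2 = (s - r) ^ 2 * (s + r) ^ 2 := by ring
      rw [this]
      nlinarith [mul_le_mul_of_nonneg_left h4 (sq_nonneg (s - r))]
    nlinarith
  have h1 := key p q hp hp' hq hq'
  have h2 := key (1 - p) (1 - q) (by linarith) (by linarith) (by linarith) (by linarith)
  nlinarith

/-! ### Offset Rademacher complexity of linear classes -/

/-- The sign encoded by a Boolean. -/
def sign (b : Bool) : ℝ := if b then 1 else -1

/-- The one-sign case of the contraction principle. For a pair (i, j), the gain g i - g j is at most
|t i - t j|; the sign of t i - t j decides which of i and j is used in the supremum with + t. -/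
theorem ciSup_add_ciSup_sub_le {ι : Type*} [Finite ι] [Nonempty ι] (A g t : ι → ℝ)
    (h : ∀ i j, |g i - g j| ≤ |t i - t j|) :
    (⨆ i, (A i + g i)) + (⨆ i, (A i - g i)) ≤ (⨆ i, (A i + t i)) + (⨆ i, (A i - t i)) := by
  have key : ∀ i j, (A i + g i) + (A j - g j) ≤ (⨆ i, (A i + t i)) + (⨆ i, (A i - t i)) := by
    intro i j
    have hp : ∀ i, A i + t i ≤ ⨆ i, (A i + t i) :=
      fun i => le_ciSup (f := fun i => A i + t i) (Set.finite_range _).bddAbove i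
    have hm : ∀ i, A i - t i ≤ ⨆ i, (A i - t i) :=
      fun i => le_ciSup (f := fun i => A i - t i) (Set.finite_range _).bddAbove i
    have h1 := (le_abs_self _).trans (h i j)
    rcases abs_cases (t i - t j) with h2 | h2
    · linarith [hp i, hm j]
    · linarith [hp j, hm i]
  rw [← le_sub_iff_add_le]
  refine ciSup_le fun i => ?_
  rw [le_sub_iff_add_le, add_comm, ← le_sub_iff_add_le]
  refine ciSup_le fun j => ?_
  linarith [key i j]

theorem sum_signs_succ {n : ℕ} (f : (Fin (n + 1) → Bool) → ℝ) :
    ∑ ε, f ε = ∑ ε : Fin n → Bool, (f (Fin.cons true ε) + f (Fin.cons false ε)) := by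
  rw [← (Fin.consEquiv fun _ : Fin (n + 1) => Bool).sum_comp, Fintype.sum_prod_type,
    Fintype.sum_bool, ← Finset.sum_add_distrib]
  rfl

/-- The contraction principle for finite Rademacher processes. -/
theorem sum_signs_contraction {ι : Type*} [Finite ι] [Nonempty ι] :
    ∀ (n : ℕ) (g t : Fin n → ι → ℝ), (∀ k i j, |g k i - g k j| ≤ |t k i - t k j|) →
      ∀ A : ι → ℝ, ∑ ε : Fin n → Bool, (⨆ i, (A i + ∑ k, sign (ε k) * g k i))
        ≤ ∑ ε : Fin n → Bool, (⨆ i, (A i + ∑ k, sign (ε k) * t k i))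
  | 0, g, t, _, A => by simp
  | n + 1, g, t, h, A => by
    rw [sum_signs_succ, sum_signs_succ]
    simp only [Fin.sum_univ_succ, Fin.cons_zero, Fin.cons_succ]
    have h1 : ∀ ε : Fin n → Bool,
        (⨆ i, (A i + (sign true * g 0 i + ∑ k : Fin n, sign (ε k) * g k.succ i)))
        + (⨆ i, (A i + (sign false * g 0 i + ∑ k : Fin n, sign (ε k) * g k.succ i)))
        ≤ (⨆ i, ((A i + t 0 i) + ∑ k : Fin n, sign (ε k) * g k.succ i))
        + (⨆ i, ((A i - t 0 i) + ∑ k : Fin n, sign (ε k) * g k.succ i)) := by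
      intro ε
      convert ciSup_add_ciSup_sub_le (fun i => A i + ∑ k : Fin n, sign (ε k) * g k.succ i)
        (g 0) (t 0) (h 0) using 4 <;> simp [sign] <;> ring
    refine (Finset.sum_le_sum fun ε _ => h1 ε).trans ?_
    rw [Finset.sum_add_distrib, Finset.sum_add_distrib]
    -- The replaced first coordinate ± t 0 is absorbed into the offset, which is why the induction
    -- runs over all A.
    have h2 := sum_signs_contraction n (fun k => g k.succ) (fun k => t k.succ)
      (fun k => h k.succ) (fun i => A i + t 0 i)
    have h3 := sum_signs_contraction n (fun k => g k.succ) (fun k => t k.succ)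
      (fun k => h k.succ) (fun i => A i - t 0 i)
    refine (add_le_add h2 h3).trans_eq ?_
    congr 1 <;> refine Finset.sum_congr rfl fun ε _ => iSup_congr fun i => ?_ <;>
      simp [sign] <;> ring

/-- Averaging over the first sign cancels its cross terms: Rademacher signs are orthonormal. -/
theorem sum_signs_sq : ∀ (n : ℕ) (b : Fin n → ℝ),
    ∑ ε : Fin n → Bool, (∑ k, sign (ε k) * b k) ^ 2 = 2 ^ n * ∑ k, b k ^ 2
  | 0, b => by simp
  | n + 1, b => by
    rw [sum_signs_succ]
    simp only [Fin.sum_univ_succ, Fin.cons_zero, Fin.cons_succ]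
    have h : ∀ ε : Fin n → Bool,
        (sign true * b 0 + ∑ k : Fin n, sign (ε k) * b k.succ) ^ 2
          + (sign false * b 0 + ∑ k : Fin n, sign (ε k) * b k.succ) ^ 2
        = 2 * b 0 ^ 2 + 2 * (∑ k : Fin n, sign (ε k) * b k.succ) ^ 2 := by
      intro ε
      simp only [sign]
      simp
      ring
    rw [Finset.sum_congr rfl fun ε _ => h ε, Finset.sum_add_distrib, ← Finset.mul_sum,
      ← Finset.mul_sum, sum_signs_sq n fun k => b k.succ]
    simp
    ring

/-- The offset Rademacher complexity of a `d`-dimensional linear class is `O(d)`. -/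
theorem sum_signs_linear_offset {ι : Type*} [Nonempty ι] {n d : ℕ} (x : Fin n → Vec d)
    (Δ : ι → Vec d) (K : ℝ) {c : ℝ} (hc : 0 < c) :
    ∑ ε : Fin n → Bool, (⨆ i, (-(c / 2) * ∑ k, (inner ℝ (x k) (Δ i)) ^ 2
        + ∑ k, sign (ε k) * (K * inner ℝ (x k) (Δ i))))
      ≤ 2 ^ n * (K ^ 2 * d / (2 * c)) := by
  let T : Vec d →ₗ[ℝ] EuclideanSpace ℝ (Fin n) :=
    { toFun := fun v => WithLp.toLp 2 fun k => inner ℝ (x k) v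
      map_add' := fun v w => by ext k; simp [inner_add_right]
      map_smul' := fun r v => by ext k; simp [inner_smul_right] }
  -- Prediction vectors (⟨x k, v⟩)ₖ fill a subspace of dimension at most d, whatever n is. Its own
  -- orthonormal basis diagonalizes the quadratic offset, so the design need not be well
  -- conditioned.
  let V := LinearMap.range T
  let b := stdOrthonormalBasis ℝ V
  have hsup : ∀ ε : Fin n → Bool, (⨆ i, (-(c / 2) * ∑ k, (inner ℝ (x k) (Δ i)) ^ 2
        + ∑ k, sign (ε k) * (K * inner ℝ (x k) (Δ i))))
      ≤ ∑ j, K ^ 2 / (2 * c) * (∑ k, sign (ε k) * (b j : EuclideanSpace ℝ (Fin n)) k) ^ 2 := by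
    intro ε
    refine ciSup_le fun i => ?_
    let t : V := ⟨T (Δ i), LinearMap.mem_range_self T _⟩
    have h1 : ∑ k, (inner ℝ (x k) (Δ i)) ^ 2 = ∑ j, (b.repr t j) ^ 2 := by
      have e1 : ‖t‖ ^ 2 = ∑ k, (inner ℝ (x k) (Δ i)) ^ 2 := by
        change ‖T (Δ i)‖ ^ 2 = _
        rw [EuclideanSpace.norm_sq_eq]
        simp [T]
      rw [← e1, ← b.repr.norm_map, EuclideanSpace.norm_sq_eq]
      simp
    have h2 : ∀ k, inner ℝ (x k) (Δ i)
        = ∑ j, b.repr t j * (b j : EuclideanSpace ℝ (Fin n)) k := by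
      intro k
      have e := congrArg (fun v : V => (v : EuclideanSpace ℝ (Fin n)) k) (b.sum_repr t)
      simp only [Submodule.coe_sum, Submodule.coe_smul] at e
      have e3 : (t : EuclideanSpace ℝ (Fin n)) k = inner ℝ (x k) (Δ i) := rfl
      rw [← e3, ← e]
      simp
    have h3 : ∑ k, sign (ε k) * (K * inner ℝ (x k) (Δ i))
        = ∑ j, K * b.repr t j * ∑ k, sign (ε k) * (b j : EuclideanSpace ℝ (Fin n)) k := by
      simp_rw [h2, Finset.mul_sum]
      rw [Finset.sum_comm]
      refine Finset.sum_congr rfl fun j _ => Finset.sum_congr rfl fun k _ => by ring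
    rw [h1, h3, Finset.mul_sum, ← Finset.sum_add_distrib]
    refine Finset.sum_le_sum fun j _ => ?_
    set s := ∑ k, sign (ε k) * (b j : EuclideanSpace ℝ (Fin n)) k
    -- Completing the square in one coordinate a: K a s - (c/2) a² ≤ K² s²/(2c).
    rw [div_mul_eq_mul_div, le_div_iff₀ (by positivity)]
    nlinarith [sq_nonneg (K * s - c * b.repr t j)]
  refine (Finset.sum_le_sum fun ε _ => hsup ε).trans ?_
  rw [Finset.sum_comm]
  have h4 : ∀ j, ∑ ε : Fin n → Bool,
      K ^ 2 / (2 * c) * (∑ k, sign (ε k) * (b j : EuclideanSpace ℝ (Fin n)) k) ^ 2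
      = K ^ 2 / (2 * c) * 2 ^ n := by
    intro j
    rw [← Finset.mul_sum, sum_signs_sq]
    have : ∑ k, ((b j : EuclideanSpace ℝ (Fin n)) k) ^ 2 = 1 := by
      have e : ‖(b j : EuclideanSpace ℝ (Fin n))‖ ^ 2 = 1 := by
        have h1 : ‖b j‖ = 1 := b.norm_eq_one j
        rw [← Submodule.coe_norm, h1, one_pow]
      rw [← e, EuclideanSpace.norm_sq_eq]
      simp
    rw [this, mul_one]
  rw [Finset.sum_congr rfl fun j _ => h4 j, Finset.sum_const, Finset.card_univ, Fintype.card_fin,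
    nsmul_eq_mul]
  have h5 : (Module.finrank ℝ V : ℝ) ≤ d := by
    have := LinearMap.finrank_range_le T
    rw [finrank_euclideanSpace_fin] at this
    exact_mod_cast this
  have h6 : 0 ≤ K ^ 2 / (2 * c) * 2 ^ n := by positivity
  refine (mul_le_mul_of_nonneg_right h5 h6).trans_eq ?_
  ring

/-- Offset Rademacher complexity of functions that are Lipschitz in a `d`-dimensional linear
class. -/
theorem sum_signs_lipschitz_offset {ι : Type*} [Finite ι] [Nonempty ι] {n d : ℕ}
    (x : Fin n → Vec d) (Δ : ι → Vec d) {K : ℝ} (hK : 0 ≤ K) {c : ℝ} (hc : 0 < c)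
    (g : Fin n → ι → ℝ)
    (hg : ∀ k i j, |g k i - g k j| ≤ K * |inner ℝ (x k) (Δ i) - inner ℝ (x k) (Δ j)|) :
    ∑ ε : Fin n → Bool, (⨆ i, (-(c / 2) * ∑ k, (inner ℝ (x k) (Δ i)) ^ 2
        + ∑ k, sign (ε k) * g k i)) ≤ 2 ^ n * (K ^ 2 * d / (2 * c)) := by
  refine (sum_signs_contraction n g (fun k i => K * inner ℝ (x k) (Δ i)) (fun k i j => ?_)
    _).trans (sum_signs_linear_offset x Δ K hc)
  rw [← mul_sub, abs_mul, abs_of_nonneg hK]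
  exact hg k i j

/-! ### Symmetrization of offset empirical processes -/

theorem abs_ciSup_le_sum {ι : Type*} [Fintype ι] [Nonempty ι] (f : ι → ℝ) :
    |⨆ i, f i| ≤ ∑ i, |f i| := by
  obtain ⟨i, hi⟩ := exists_eq_ciSup_of_finite (f := f)
  rw [← hi]
  exact Finset.single_le_sum (f := fun i => |f i|) (fun i _ => abs_nonneg (f i))
    (Finset.mem_univ i)

theorem integrable_ciSup {α ι : Type*} [MeasurableSpace α] {μ : Measure α} [Fintype ι]
    [Nonempty ι] {f : ι → α → ℝ} (hm : ∀ i, Measurable (f i)) (hf : ∀ i, Integrable (f i) μ) :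
    Integrable (fun a => ⨆ i, f i a) μ :=
  (integrable_finsetSum Finset.univ fun i _ => (hf i).abs).mono'
    (Measurable.iSup hm).aestronglyMeasurable
    (Filter.Eventually.of_forall fun a => abs_ciSup_le_sum fun i => f i a)

theorem ae_pi_forall {E : Type*} [MeasurableSpace E] {μ : Measure E} [IsProbabilityMeasure μ]
    {n : ℕ} {p : E → Prop} (h : ∀ᵐ z ∂μ, p z) :
    ∀ᵐ z ∂(Measure.pi fun _ : Fin n => μ), ∀ k, p (z k) :=
  ae_all_iff.2 fun k =>
    (measurePreserving_eval (fun _ : Fin n => μ) k).quasiMeasurePreserving.ae h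

section Symmetrization

variable {E : Type*} [MeasurableSpace E] {μ : Measure E} [IsProbabilityMeasure μ] {n d : ℕ}

/-- Jensen's inequality for the supremum; it introduces the ghost sample in the symmetrization. -/
theorem iSup_sum_integral_le {ι : Type*} [Finite ι] [Nonempty ι] {f : Fin n → ι → E → ℝ}
    (hm : ∀ k i, Measurable (f k i)) (hf : ∀ k i, Integrable (f k i) μ) :
    (⨆ i, ∑ k, ∫ y, f k i y ∂μ)
      ≤ ∫ z, (⨆ i, ∑ k, f k i (z k)) ∂(Measure.pi fun _ : Fin n => μ) := by
  let _ := Fintype.ofFinite ι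
  have hint : ∀ k i, Integrable (fun z : Fin n → E => f k i (z k)) (Measure.pi fun _ => μ) :=
    fun k i =>
      (measurePreserving_eval (fun _ : Fin n => μ) k).integrable_comp_of_integrable (hf k i)
  refine ciSup_le fun i => ?_
  have e : ∑ k, ∫ y, f k i y ∂μ
      = ∫ z, ∑ k, f k i (z k) ∂(Measure.pi fun _ : Fin n => μ) := by
    rw [integral_finsetSum _ fun k _ => hint k i]
    exact Finset.sum_congr rfl fun k _ =>
      (integral_comp_eval (μ := fun _ : Fin n => μ) (hf k i).aestronglyMeasurable).symm
  rw [e]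
  exact integral_mono (integrable_finsetSum _ fun k _ => hint k i)
    (integrable_ciSup (fun j => Finset.measurable_sum _ fun k _ =>
      (hm k j).comp (measurable_pi_apply k)) fun j => integrable_finsetSum _ fun k _ => hint k j)
    fun z => le_ciSup (f := fun i => ∑ k, f k i (z k)) (Set.finite_range _).bddAbove i

theorem integral_sub_const_sub {f g : E → ℝ} (hf : Integrable f μ) (a : ℝ)
    (hg : Integrable g μ) :
    ∫ y, (f y - a - g y) ∂μ = (∫ y, f y ∂μ) - a - ∫ y, g y ∂μ := by
  have h : Integrable (fun y => f y - a) μ := hf.sub (integrable_const a)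
  rw [integral_sub h hg, integral_sub hf (integrable_const a)]
  simp

/-- Swap the two components of the pairs whose index carries a negative sign. -/
def signSwap (ε : Fin n → Bool) (p : Fin n → E × E) : Fin n → E × E :=
  fun k => if ε k then p k else (p k).swap

/-- A sample point and its ghost are exchangeable, so random signs can be inserted without changing
expectations. -/
theorem measurePreserving_signSwap (ε : Fin n → Bool) :
    MeasurePreserving (signSwap (E := E) ε) (Measure.pi fun _ => μ.prod μ)
      (Measure.pi fun _ => μ.prod μ) := by
  refine measurePreserving_pi (fun _ => μ.prod μ) (fun _ => μ.prod μ)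
    (f := fun k p => if ε k then p else p.swap) fun k => ?_
  cases ε k
  · simpa using Measure.measurePreserving_swap (μ := μ) (ν := μ)
  · exact MeasurePreserving.id (μ.prod μ)

/-- Symmetrization of an offset empirical process, with the quadratic offset of a linear class. -/
theorem integral_iSup_offset_le {ι : Type*} [Finite ι] [Nonempty ι] {X : E → Vec d}
    (hX : Measurable X) (Δ : ι → Vec d) {h : ι → E → ℝ} (hh : ∀ i, Measurable (h i))
    (hint : ∀ i, Integrable (h i) μ) {L B c : ℝ} (hL : 0 ≤ L) (hB : 0 ≤ B) (hc : 0 < c)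
    (hlip : ∀ᵐ z ∂μ, ∀ i j,
      |h i z - h j z| ≤ L * |inner ℝ (X z) (Δ i) - inner ℝ (X z) (Δ j)|)
    (hbd : ∀ᵐ z ∂μ, ∀ i, |inner ℝ (X z) (Δ i)| ≤ B) :
    Integrable (fun z => ⨆ i, ∑ k, ((∫ y, h i y ∂μ) - h i (z k)
        - c * ∫ y, (inner ℝ (X y) (Δ i)) ^ 2 ∂μ)) (Measure.pi fun _ : Fin n => μ) ∧
    ∫ z, (⨆ i, ∑ k, ((∫ y, h i y ∂μ) - h i (z k) - c * ∫ y, (inner ℝ (X y) (Δ i)) ^ 2 ∂μ))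
      ∂(Measure.pi fun _ : Fin n => μ) ≤ (L + c * B) ^ 2 * d / c := by
  let _ := Fintype.ofFinite ι
  set q : ι → E → ℝ := fun i z => (inner ℝ (X z) (Δ i)) ^ 2 with hq
  have hqm : ∀ i, Measurable (q i) := fun i => (hX.inner measurable_const).pow_const 2
  have hqi : ∀ i, Integrable (q i) μ := by
    intro i
    refine Integrable.of_bound (hqm i).aestronglyMeasurable (B ^ 2) ?_
    filter_upwards [hbd] with z hz
    rw [Real.norm_eq_abs, abs_of_nonneg (sq_nonneg _)]
    exact sq_le_sq.2 ((hz i).trans (le_abs_self B))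
  -- The first component is the sample and the second the ghost; the offset is charged entirely to
  -- the ghost here and is shared equally once signs are inserted.
  set D : ι → E × E → ℝ := fun i p => h i p.2 - h i p.1 - c * q i p.2 with hD
  have hDm : ∀ i, Measurable (D i) := fun i =>
    (((hh i).comp measurable_snd).sub ((hh i).comp measurable_fst)).sub
      (((hqm i).comp measurable_snd).const_mul c)
  have hDi : ∀ i, Integrable (D i) (μ.prod μ) := fun i =>
    (((hint i).comp_snd μ).sub ((hint i).comp_fst μ)).sub (((hqi i).comp_snd μ).const_mul c)
  set S : (Fin n → E × E) → ℝ := fun p => ⨆ i, ∑ k, D i (p k) with hS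
  have hSm : Measurable S := Measurable.iSup fun i =>
    Finset.measurable_sum _ fun k _ => (hDm i).comp (measurable_pi_apply k)
  have hSi : Integrable S (Measure.pi fun _ : Fin n => μ.prod μ) :=
    integrable_ciSup (fun i => Finset.measurable_sum _ fun k _ =>
      (hDm i).comp (measurable_pi_apply k))
      fun i => integrable_finsetSum _ fun k _ =>
        (measurePreserving_eval (fun _ : Fin n => μ.prod μ) k).integrable_comp_of_integrable (hDi i)
  have hWi : Integrable (fun z => ⨆ i, ∑ k, ((∫ y, h i y ∂μ) - h i (z k) - c * ∫ y, q i y ∂μ))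
      (Measure.pi fun _ : Fin n => μ) :=
    integrable_ciSup (fun i => Finset.measurable_sum _ fun k _ =>
      ((measurable_const.sub ((hh i).comp (measurable_pi_apply k))).sub measurable_const))
      fun i => integrable_finsetSum _ fun k _ => ((integrable_const _).sub
        ((measurePreserving_eval (fun _ : Fin n => μ) k).integrable_comp_of_integrable
          (hint i))).sub (integrable_const _)
  refine ⟨hWi, ?_⟩
  have mp := measurePreserving_arrowProdEquivProdArrow E E (Fin n) (fun _ => μ) (fun _ => μ)
  set e := MeasurableEquiv.arrowProdEquivProdArrow E E (Fin n)
  have hSi' : Integrable (fun zz : (Fin n → E) × (Fin n → E) => S fun k => (zz.1 k, zz.2 k))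
      ((Measure.pi fun _ => μ).prod (Measure.pi fun _ => μ)) := by
    rw [← mp.integrable_comp_emb e.measurableEmbedding]
    exact hSi
  have step1 : ∫ z, (⨆ i, ∑ k, ((∫ y, h i y ∂μ) - h i (z k) - c * ∫ y, q i y ∂μ))
      ∂(Measure.pi fun _ : Fin n => μ) ≤ ∫ p, S p ∂(Measure.pi fun _ : Fin n => μ.prod μ) := by
    have e1 : ∫ p, S p ∂(Measure.pi fun _ : Fin n => μ.prod μ)
        = ∫ z, ∫ z', S (fun k => (z k, z' k)) ∂(Measure.pi fun _ => μ)
          ∂(Measure.pi fun _ => μ) := by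
      rw [← integral_prod _ hSi', ← mp.integral_comp']
      rfl
    rw [e1]
    refine integral_mono hWi hSi'.integral_prod_left fun z => ?_
    have hz : ∀ k i, Integrable (fun y => D i (z k, y)) μ := fun k i =>
      ((hint i).sub (integrable_const (h i (z k)))).sub ((hqi i).const_mul c)
    refine le_trans (le_of_eq (iSup_congr fun i => Finset.sum_congr rfl fun k _ => ?_))
      (iSup_sum_integral_le (fun k i => (hDm i).comp measurable_prodMk_left) hz)
    exact (integral_sub_const_sub (hint i) (h i (z k)) ((hqi i).const_mul c) |>.trans
      (by rw [integral_const_mul])).symm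
  refine step1.trans ?_
  have hswap : ∀ ε : Fin n → Bool, ∫ p, S (signSwap ε p) ∂(Measure.pi fun _ : Fin n => μ.prod μ)
      = ∫ p, S p ∂(Measure.pi fun _ : Fin n => μ.prod μ) := fun ε => by
    conv_rhs => rw [← (measurePreserving_signSwap (μ := μ) ε).map_eq]
    rw [integral_map (measurePreserving_signSwap (μ := μ) ε).measurable.aemeasurable
      hSm.aestronglyMeasurable]
  have hswapi : ∀ ε : Fin n → Bool,
      Integrable (fun p => S (signSwap ε p)) (Measure.pi fun _ : Fin n => μ.prod μ) := fun ε =>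
    (measurePreserving_signSwap (μ := μ) ε).integrable_comp_of_integrable hSi
  -- Under any sign ε, the increment equals ε (g(ghost) - g(sample)) - (c/2)(q(sample) + q(ghost)).
  -- Correcting h by (c/2) q makes the remaining offset sign-free, at the price of raising the
  -- Lipschitz constant from L to L + c B.
  set g : ι → E → ℝ := fun i z => h i z - c / 2 * q i z with hg
  have hglip : ∀ᵐ z ∂μ, ∀ i j,
      |g i z - g j z| ≤ (L + c * B) * |inner ℝ (X z) (Δ i) - inner ℝ (X z) (Δ j)| := by
    filter_upwards [hlip, hbd] with z h1 h2 i j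
    have e1 : g i z - g j z = (h i z - h j z) - c / 2 * (inner ℝ (X z) (Δ i)
        + inner ℝ (X z) (Δ j)) * (inner ℝ (X z) (Δ i) - inner ℝ (X z) (Δ j)) := by
      simp only [hg, hq]; ring
    have e2 : |c / 2 * (inner ℝ (X z) (Δ i) + inner ℝ (X z) (Δ j))
          * (inner ℝ (X z) (Δ i) - inner ℝ (X z) (Δ j))|
        ≤ c * B * |inner ℝ (X z) (Δ i) - inner ℝ (X z) (Δ j)| := by
      rw [abs_mul]
      refine mul_le_mul_of_nonneg_right ?_ (abs_nonneg _)
      rw [abs_mul, abs_of_pos (half_pos hc)]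
      have := (abs_add_le (inner ℝ (X z) (Δ i)) (inner ℝ (X z) (Δ j))).trans
        (add_le_add (h2 i) (h2 j))
      nlinarith
    rw [e1, add_mul]
    exact (abs_sub _ _).trans (add_le_add (h1 i j) e2)
  have hpt : ∀ᵐ p ∂(Measure.pi fun _ : Fin n => μ.prod μ),
      ∑ ε : Fin n → Bool, S (signSwap ε p) ≤ 2 ^ n * ((L + c * B) ^ 2 * d / c) := by
    have h1 : ∀ᵐ p ∂(μ.prod μ), ∀ i j,
        |g i p.1 - g j p.1| ≤ (L + c * B) * |inner ℝ (X p.1) (Δ i) - inner ℝ (X p.1) (Δ j)| :=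
      Measure.quasiMeasurePreserving_fst.ae hglip
    have h2 : ∀ᵐ p ∂(μ.prod μ), ∀ i j,
        |g i p.2 - g j p.2| ≤ (L + c * B) * |inner ℝ (X p.2) (Δ i) - inner ℝ (X p.2) (Δ j)| :=
      Measure.quasiMeasurePreserving_snd.ae hglip
    filter_upwards [ae_pi_forall h1, ae_pi_forall h2] with p hp1 hp2
    have hK : 0 ≤ L + c * B := by positivity
    have b1 := sum_signs_lipschitz_offset (fun k => X (p k).1) Δ hK hc
      (fun k i => -g i (p k).1) fun k i j => by
        rw [← abs_neg]
        convert hp1 k i j using 2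
        ring
    have b2 := sum_signs_lipschitz_offset (fun k => X (p k).2) Δ hK hc
      (fun k i => g i (p k).2) fun k i j => hp2 k i j
    have b3 : ∀ ε : Fin n → Bool, S (signSwap ε p)
        ≤ (⨆ i, (-(c / 2) * ∑ k, (inner ℝ (X (p k).1) (Δ i)) ^ 2
            + ∑ k, sign (ε k) * -g i (p k).1))
          + ⨆ i, (-(c / 2) * ∑ k, (inner ℝ (X (p k).2) (Δ i)) ^ 2
            + ∑ k, sign (ε k) * g i (p k).2) := by
      intro ε
      refine ciSup_le fun i => ?_
      have e1 : ∑ k, D i (signSwap ε p k)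
          = (-(c / 2) * ∑ k, (inner ℝ (X (p k).1) (Δ i)) ^ 2 + ∑ k, sign (ε k) * -g i (p k).1)
          + (-(c / 2) * ∑ k, (inner ℝ (X (p k).2) (Δ i)) ^ 2
            + ∑ k, sign (ε k) * g i (p k).2) := by
        simp only [Finset.mul_sum]
        rw [← Finset.sum_add_distrib, ← Finset.sum_add_distrib, ← Finset.sum_add_distrib]
        refine Finset.sum_congr rfl fun k _ => ?_
        simp only [signSwap, sign, hD, hg, hq]
        cases ε k <;> simp <;> ring
      rw [e1]
      exact add_le_add
        (le_ciSup (f := fun i => -(c / 2) * ∑ k, (inner ℝ (X (p k).1) (Δ i)) ^ 2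
            + ∑ k, sign (ε k) * -g i (p k).1) (Set.finite_range _).bddAbove i)
        (le_ciSup (f := fun i => -(c / 2) * ∑ k, (inner ℝ (X (p k).2) (Δ i)) ^ 2
            + ∑ k, sign (ε k) * g i (p k).2) (Set.finite_range _).bddAbove i)
    refine (Finset.sum_le_sum fun ε _ => b3 ε).trans ?_
    rw [Finset.sum_add_distrib]
    refine (add_le_add b1 b2).trans_eq ?_
    field_simp
    norm_num
  have hfin : 2 ^ n * ∫ p, S p ∂(Measure.pi fun _ : Fin n => μ.prod μ)
      ≤ 2 ^ n * ((L + c * B) ^ 2 * d / c) := by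
    calc 2 ^ n * ∫ p, S p ∂(Measure.pi fun _ : Fin n => μ.prod μ)
        = ∫ p, ∑ ε : Fin n → Bool, S (signSwap ε p) ∂(Measure.pi fun _ : Fin n => μ.prod μ) := by
          rw [integral_finsetSum _ fun ε _ => hswapi ε, Finset.sum_congr rfl fun ε _ => hswap ε]
          simp
      _ ≤ ∫ _p, 2 ^ n * ((L + c * B) ^ 2 * d / c) ∂(Measure.pi fun _ : Fin n => μ.prod μ) :=
          integral_mono_ae (integrable_finsetSum _ fun ε _ => hswapi ε) (integrable_const _) hpt
      _ = _ := by simp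
  exact le_of_mul_le_mul_left hfin (by positivity)

end Symmetrization

/-! ### Fast rates for empirical risk and maximum likelihood -/

/-- Fast rate for empirical risk minimization over a totally bounded class of linear predictors,
when the excess loss `h` is Lipschitz and its mean dominates the quadratic risk. -/
theorem integral_erm_le {E : Type*} [MeasurableSpace E] {μ : Measure E} [IsProbabilityMeasure μ]
    {n d : ℕ} (hn : 0 < n) {X : E → Vec d} (hX : Measurable X) {H : Set (Vec d)}
    (hH : TotallyBounded H) (θ₀ : Vec d) {h : Vec d → E → ℝ} (hh : ∀ θ, Measurable (h θ))
    {L B R c : ℝ} (hL : 0 ≤ L) (hB : 0 ≤ B) (hR : 0 ≤ R) (hc : 0 < c)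
    (hgood : ∀ᵐ z ∂μ, ‖X z‖ ≤ R ∧ (∀ θ ∈ H, |h θ z| ≤ L * |inner ℝ (X z) (θ - θ₀)|) ∧
      (∀ θ ∈ H, |inner ℝ (X z) (θ - θ₀)| ≤ B) ∧
      ∀ θ ∈ H, ∀ θ' ∈ H, |h θ z - h θ' z| ≤ L * |inner ℝ (X z) (θ - θ')|)
    (hcurv : ∀ θ ∈ H, 2 * c * ∫ z, (inner ℝ (X z) (θ - θ₀)) ^ 2 ∂μ ≤ ∫ z, h θ z ∂μ)
    {est : (Fin n → E) → Vec d}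
    (hest : ∀ᵐ z ∂(Measure.pi fun _ : Fin n => μ), est z ∈ H ∧ ∑ k, h (est z) (z k) ≤ 0) :
    ∫ z, ∫ y, (inner ℝ (X y) (est z - θ₀)) ^ 2 ∂μ ∂(Measure.pi fun _ : Fin n => μ)
      ≤ (L + c * B) ^ 2 * d / (c ^ 2 * n) := by
  have hnR : (0 : ℝ) < n := Nat.cast_pos.2 hn
  obtain ⟨z₀, hz₀, -⟩ := hest.exists
  have hinth : ∀ θ ∈ H, Integrable (h θ) μ := by
    intro θ hθ
    refine Integrable.of_bound (hh θ).aestronglyMeasurable (L * B) ?_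
    filter_upwards [hgood] with z hz
    exact (hz.2.1 θ hθ).trans (mul_le_mul_of_nonneg_left (hz.2.2.1 θ hθ) hL)
  have hintq : ∀ θ ∈ H, Integrable (fun z => (inner ℝ (X z) (θ - θ₀)) ^ 2) μ := by
    intro θ hθ
    refine Integrable.of_bound ((hX.inner measurable_const).pow_const 2).aestronglyMeasurable
      (B ^ 2) ?_
    filter_upwards [hgood] with z hz
    rw [Real.norm_eq_abs, abs_of_nonneg (sq_nonneg _), ← sq_abs]
    exact pow_le_pow_left₀ (abs_nonneg _) (hz.2.2.1 θ hθ) 2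
  -- A finite δ-net keeps the supremum finite, as symmetrization requires. The leading term does not
  -- depend on the size of the net, so δ can tend to 0 with no entropy cost.
  have key : ∀ δ > 0, ∫ z, ∫ y, (inner ℝ (X y) (est z - θ₀)) ^ 2 ∂μ
      ∂(Measure.pi fun _ : Fin n => μ)
      ≤ (L + c * B) ^ 2 * d / (c ^ 2 * n) + (2 * L * R + 2 * c * B * R) / c * δ := by
    intro δ hδ
    obtain ⟨t, htH, htf, hcov⟩ := Metric.finite_approx_of_totallyBounded hH δ hδ
    have htne : t.Nonempty := by
      obtain ⟨θ, hθ, -⟩ := Set.mem_iUnion₂.1 (hcov hz₀)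
      exact ⟨θ, hθ⟩
    have : Finite t := htf
    have : Nonempty t := htne.to_subtype
    obtain ⟨hWi, hW⟩ := integral_iSup_offset_le (n := n) hX (fun θ : t => (θ : Vec d) - θ₀)
      (h := fun θ : t => h θ) (fun θ => hh θ) (fun θ => hinth θ (htH θ.2)) hL hB hc
      (by
        filter_upwards [hgood] with z hz i j
        rw [← inner_sub_right, sub_sub_sub_cancel_right]
        exact hz.2.2.2 i (htH i.2) j (htH j.2))
      (by
        filter_upwards [hgood] with z hz i
        exact hz.2.2.1 i (htH i.2))
    have hpt : ∀ᵐ z ∂(Measure.pi fun _ : Fin n => μ),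
        ∫ y, (inner ℝ (X y) (est z - θ₀)) ^ 2 ∂μ ≤ (c * n)⁻¹ *
          (⨆ θ : t, ∑ k, ((∫ y, h θ y ∂μ) - h θ (z k)
            - c * ∫ y, (inner ℝ (X y) ((θ : Vec d) - θ₀)) ^ 2 ∂μ))
          + (2 * L * R + 2 * c * B * R) / c * δ := by
      filter_upwards [hest, ae_pi_forall hgood] with z ⟨hzH, hz0⟩ hzg
      obtain ⟨θ', hθ't, hθ'⟩ := Set.mem_iUnion₂.1 (hcov hzH)
      have hθ'H := htH hθ't
      set θ := est z
      have hd : ‖θ - θ'‖ ≤ δ := by rw [← dist_eq_norm]; exact (Metric.mem_ball.1 hθ').le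
      have hin : ∀ x : Vec d, ‖x‖ ≤ R → |inner ℝ x (θ - θ')| ≤ R * δ := fun x hx =>
        (abs_real_inner_le_norm _ _).trans (mul_le_mul hx hd (norm_nonneg _) hR)
      have b1 : ∀ k, h θ' (z k) ≤ h θ (z k) + L * (R * δ) := fun k => by
        have h1 := (hzg k).2.2.2 θ hzH θ' hθ'H
        have h2 := mul_le_mul_of_nonneg_left (hin _ (hzg k).1) hL
        linarith [neg_abs_le (h θ (z k) - h θ' (z k))]
      have b2 : ∫ y, h θ y ∂μ ≤ (∫ y, h θ' y ∂μ) + L * (R * δ) := by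
        calc ∫ y, h θ y ∂μ ≤ ∫ y, (h θ' y + L * (R * δ)) ∂μ := by
              refine integral_mono_ae (hinth θ hzH) ((hinth θ' hθ'H).add (integrable_const _)) ?_
              filter_upwards [hgood] with y hy
              have h1 := hy.2.2.2 θ hzH θ' hθ'H
              have h2 := mul_le_mul_of_nonneg_left (hin _ hy.1) hL
              linarith [le_abs_self (h θ y - h θ' y)]
          _ = _ := by rw [integral_add (hinth θ' hθ'H) (integrable_const _)]; simp
      have b3 : ∫ y, (inner ℝ (X y) (θ' - θ₀)) ^ 2 ∂μ
          ≤ (∫ y, (inner ℝ (X y) (θ - θ₀)) ^ 2 ∂μ) + 2 * B * (R * δ) := by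
        calc ∫ y, (inner ℝ (X y) (θ' - θ₀)) ^ 2 ∂μ
            ≤ ∫ y, ((inner ℝ (X y) (θ - θ₀)) ^ 2 + 2 * B * (R * δ)) ∂μ := by
              refine integral_mono_ae (hintq θ' hθ'H)
                ((hintq θ hzH).add (integrable_const _)) ?_
              filter_upwards [hgood] with y hy
              have h1 := hy.2.2.1 θ hzH
              have h2 := hy.2.2.1 θ' hθ'H
              have h3 := hin _ hy.1
              have e1 : inner ℝ (X y) (θ - θ')
                  = inner ℝ (X y) (θ - θ₀) - inner ℝ (X y) (θ' - θ₀) := by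
                rw [← inner_sub_right, sub_sub_sub_cancel_right]
              rw [e1] at h3
              have e2 : (inner ℝ (X y) (θ' - θ₀)) ^ 2 - (inner ℝ (X y) (θ - θ₀)) ^ 2
                  = -((inner ℝ (X y) (θ - θ₀) + inner ℝ (X y) (θ' - θ₀))
                    * (inner ℝ (X y) (θ - θ₀) - inner ℝ (X y) (θ' - θ₀))) := by ring
              have e3 : |(inner ℝ (X y) (θ - θ₀) + inner ℝ (X y) (θ' - θ₀))
                    * (inner ℝ (X y) (θ - θ₀) - inner ℝ (X y) (θ' - θ₀))|
                  ≤ 2 * B * (R * δ) := by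
                rw [abs_mul]
                refine mul_le_mul ?_ h3 (abs_nonneg _) (by positivity)
                exact (abs_add_le _ _).trans (by linarith)
              linarith [neg_abs_le ((inner ℝ (X y) (θ - θ₀) + inner ℝ (X y) (θ' - θ₀))
                    * (inner ℝ (X y) (θ - θ₀) - inner ℝ (X y) (θ' - θ₀)))]
          _ = _ := by rw [integral_add (hintq θ hzH) (integrable_const _)]; simp
      have b4 := hcurv θ hzH
      set Q := ∫ y, (inner ℝ (X y) (θ - θ₀)) ^ 2 ∂μ
      -- Of the curvature 2 c Q, one half pays the offset and the other remains on the left as c Q.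
      -- Passing from θ to θ' costs L R δ in the sample, L R δ in the mean and 2 c B R δ in the
      -- offset.
      have b5 : ∑ k, (c * Q - h θ (z k) - (2 * L * R + 2 * c * B * R) * δ)
          ≤ ∑ k, ((∫ y, h θ' y ∂μ) - h θ' (z k)
            - c * ∫ y, (inner ℝ (X y) (θ' - θ₀)) ^ 2 ∂μ) := by
        refine Finset.sum_le_sum fun k _ => ?_
        have := mul_le_mul_of_nonneg_left b3 hc.le
        linarith [b1 k]
      have b6 := b5.trans (le_ciSup (f := fun θ : t => ∑ k, ((∫ y, h θ y ∂μ) - h θ (z k)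
            - c * ∫ y, (inner ℝ (X y) ((θ : Vec d) - θ₀)) ^ 2 ∂μ))
            (Set.finite_range _).bddAbove ⟨θ', hθ't⟩)
      rw [Finset.sum_sub_distrib, Finset.sum_sub_distrib, Finset.sum_const, Finset.sum_const,
        Finset.card_univ, Fintype.card_fin, nsmul_eq_mul, nsmul_eq_mul] at b6
      set W := ⨆ θ : t, ∑ k, ((∫ y, h θ y ∂μ) - h θ (z k)
            - c * ∫ y, (inner ℝ (X y) ((θ : Vec d) - θ₀)) ^ 2 ∂μ)
      have b7 : c * n * Q ≤ W + n * ((2 * L * R + 2 * c * B * R) * δ) := by linarith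
      have b8 : Q ≤ (c * n)⁻¹ * (W + n * ((2 * L * R + 2 * c * B * R) * δ)) := by
        rw [inv_mul_eq_div, le_div_iff₀ (by positivity)]
        linarith
      refine b8.trans_eq ?_
      field_simp
    calc _ ≤ ∫ z, ((c * n)⁻¹ *
          (⨆ θ : t, ∑ k, ((∫ y, h θ y ∂μ) - h θ (z k)
            - c * ∫ y, (inner ℝ (X y) ((θ : Vec d) - θ₀)) ^ 2 ∂μ))
          + (2 * L * R + 2 * c * B * R) / c * δ) ∂(Measure.pi fun _ : Fin n => μ) :=
        integral_mono_of_nonneg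
          (Filter.Eventually.of_forall fun z => integral_nonneg fun y => sq_nonneg _)
          ((hWi.const_mul _).add (integrable_const _)) hpt
      _ ≤ (c * n)⁻¹ * ((L + c * B) ^ 2 * d / c) + (2 * L * R + 2 * c * B * R) / c * δ := by
        rw [integral_add (hWi.const_mul _) (integrable_const _), integral_const_mul]
        have : 0 ≤ (c * n)⁻¹ := by positivity
        simpa using mul_le_mul_of_nonneg_left hW this
      _ = _ := by
        field_simp
  refine le_of_forall_pos_le_add fun η hη => ?_
  set C := (2 * L * R + 2 * c * B * R) / c with hC
  have hC0 : 0 ≤ C := by positivity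
  -- Dividing by C + 1 rather than C also covers C = 0.
  refine (key (η / (C + 1)) (by positivity)).trans ?_
  gcongr
  rw [mul_div_assoc', div_le_iff₀ (by positivity)]
  nlinarith

theorem measurable_negLogLik {ν : Measure ℝ} {d : ℕ} (θ : Vec d) :
    Measurable (fun o : Obs d => negLogLik ν o θ) := by
  have h : Measurable (fun o : Obs d => cdf ν (o.2.1 - inner ℝ o.1 θ)) :=
    (cdf ν).mono.measurable.comp
      ((measurable_fst.comp measurable_snd).sub (measurable_fst.inner measurable_const))
  exact Measurable.ite (measurableSet_eq_fun (measurable_snd.comp measurable_snd)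
    measurable_const) (measurable_const.sub h).log.neg h.log.neg

theorem integral_ite_le {ν : Measure ℝ} [IsProbabilityMeasure ν] (hν : IsAdmissibleNoise ν)
    (v u a b : ℝ) :
    ∫ y, (if v ≤ u + y then a else b) ∂ν = (1 - cdf ν (v - u)) * a + cdf ν (v - u) * b := by
  have h : (fun y => if v ≤ u + y then a else b)
      = fun y => (Set.Ici (v - u)).indicator (fun _ => a - b) y + b := by
    funext y
    by_cases hy : v ≤ u + y
    · have : y ∈ Set.Ici (v - u) := by simp only [Set.mem_Ici]; linarith
      simp [hy, this]
    · have : y ∉ Set.Ici (v - u) := by simp only [Set.mem_Ici]; linarith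
      simp [hy, this]
  rw [h, integral_add ((integrable_const _).indicator measurableSet_Ici) (integrable_const _),
    integral_indicator measurableSet_Ici, setIntegral_const, hν.measureReal_Ici]
  simp
  ring

/-- Lipschitz bound for the log-likelihood and quadratic growth of its mean. -/
theorem exists_negLogLik_bounds {ν : Measure ℝ} [IsProbabilityMeasure ν]
    (hν : IsAdmissibleNoise ν) {B : ℝ} (hB : 0 ≤ B) :
    ∃ L c : ℝ, 0 ≤ L ∧ 0 < c ∧ ∀ (d : ℕ) (x θ θ' : Vec d) (v : ℝ), 0 ≤ v →
      v ≤ greedyPrice ν 0 + B → 0 ≤ inner ℝ x θ → inner ℝ x θ ≤ B → 0 ≤ inner ℝ x θ' →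
      inner ℝ x θ' ≤ B →
      (∀ b : Bool, |negLogLik ν (x, v, b) θ - negLogLik ν (x, v, b) θ'|
        ≤ L * |inner ℝ x (θ - θ')|) ∧
      c * (inner ℝ x (θ - θ')) ^ 2 ≤ ∫ y, (negLogLik ν (x, v, decide (v ≤ inner ℝ x θ' + y)) θ
        - negLogLik ν (x, v, decide (v ≤ inner ℝ x θ' + y)) θ') ∂ν := by
  have hJ := hν.greedyPrice_pos 0
  -- The interval contains every v - ⟨x, θ⟩ with 0 ≤ v ≤ J(0) + B and 0 ≤ ⟨x, θ⟩ ≤ B.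
  obtain ⟨L, c, hL, hc, h⟩ := hν.exists_lipschitz (a := -B) (b := greedyPrice ν 0 + B)
    (by linarith)
  refine ⟨L, c ^ 2 / 2, hL, by positivity, fun d x θ θ' v hv0 hvB h0 h1 h0' h1' => ?_⟩
  obtain ⟨l1, l2, l3⟩ := h (v - inner ℝ x θ) ⟨by linarith, by linarith⟩ (v - inner ℝ x θ')
    ⟨by linarith, by linarith⟩
  have e : |v - inner ℝ x θ - (v - inner ℝ x θ')| = |inner ℝ x (θ - θ')| := by
    rw [inner_sub_right, abs_sub_comm]
    congr 1
    ring
  rw [e] at l1 l2 l3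
  refine ⟨fun b => ?_, ?_⟩
  · cases b
    · simp only [negLogLik, Bool.false_eq_true, if_false]
      rwa [← abs_neg, neg_sub_neg, neg_sub]
    · simp only [negLogLik, if_true]
      rwa [← abs_neg, neg_sub_neg, neg_sub]
  · have e2 : ∀ y, negLogLik ν (x, v, decide (v ≤ inner ℝ x θ' + y)) θ
        - negLogLik ν (x, v, decide (v ≤ inner ℝ x θ' + y)) θ'
        = if v ≤ inner ℝ x θ' + y then
            Real.log (1 - cdf ν (v - inner ℝ x θ')) - Real.log (1 - cdf ν (v - inner ℝ x θ))
          else Real.log (cdf ν (v - inner ℝ x θ')) - Real.log (cdf ν (v - inner ℝ x θ)) := by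
      intro y
      by_cases hy : v ≤ inner ℝ x θ' + y <;> simp [negLogLik, hy] <;> ring
    simp only [e2]
    rw [integral_ite_le hν]
    have k := bernoulli_entropy_ge (hν.cdf_pos (v - inner ℝ x θ'))
      (hν.cdf_lt_one (v - inner ℝ x θ')) (hν.cdf_pos (v - inner ℝ x θ))
      (hν.cdf_lt_one (v - inner ℝ x θ))
    have k2 : c ^ 2 * (inner ℝ x (θ - θ')) ^ 2
        ≤ (cdf ν (v - inner ℝ x θ') - cdf ν (v - inner ℝ x θ)) ^ 2 := by
      rw [← mul_pow]
      refine sq_le_sq.2 ?_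
      rw [abs_mul, abs_of_pos hc, abs_sub_comm (cdf ν (v - inner ℝ x θ'))]
      exact l3
    linarith

/-- The record of a round with feature `z.1` and noise `z.2` in which the greedy price for the
parameter `a` is posted. -/
noncomputable def greedyObs {d : ℕ} (ν : Measure ℝ) (θ a : Vec d) (z : Vec d × ℝ) : Obs d :=
  (z.1, greedyPrice ν (inner ℝ z.1 a),
    decide (greedyPrice ν (inner ℝ z.1 a) ≤ inner ℝ z.1 θ + z.2))

theorem measurable_greedyObs {ν : Measure ℝ} (hν : IsAdmissibleNoise ν) {d : ℕ} (θ a : Vec d) :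
    Measurable (greedyObs ν θ a) := by
  have h : Measurable fun z : Vec d × ℝ => greedyPrice ν (inner ℝ z.1 a) :=
    hν.measurable_greedyPrice.comp (measurable_fst.inner measurable_const)
  refine measurable_fst.prodMk (h.prodMk (measurable_to_bool ?_))
  have : (fun z : Vec d × ℝ => decide (greedyPrice ν (inner ℝ z.1 a) ≤ inner ℝ z.1 θ + z.2)) ⁻¹'
      {true} = {z | greedyPrice ν (inner ℝ z.1 a) ≤ inner ℝ z.1 θ + z.2} := by
    ext z; simp
  rw [this]
  exact measurableSet_le h ((measurable_fst.inner measurable_const).add measurable_snd)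

/-- Fast rate of maximum likelihood from an epoch of `n` rounds with greedy prices. -/
theorem exists_maxLikelihood_rate {ν : Measure ℝ} [IsProbabilityMeasure ν]
    (hν : IsAdmissibleNoise ν) {B : ℝ} (hB : 0 ≤ B) :
    ∃ C : ℝ, 0 ≤ C ∧ ∀ (d n : ℕ) (R₁ R₂ : ℝ) (H D : Set (Vec d)), 0 < n → 0 ≤ R₂ →
      (∀ θ ∈ H, ‖θ‖ ≤ R₁) → (∀ z ∈ D, ‖z‖ ≤ R₂) →
      (∀ z ∈ D, ∀ θ ∈ H, 0 ≤ inner ℝ z θ ∧ inner ℝ z θ ≤ B) →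
      ∀ θ₀ ∈ H, ∀ a ∈ H, ∀ (𝔻 : Measure (Vec d)) [IsProbabilityMeasure 𝔻],
      (∀ᵐ z ∂𝔻, z ∈ D) → ∀ est : (Fin n → Vec d × ℝ) → Vec d,
      (∀ᵐ z ∂(Measure.pi fun _ : Fin n => 𝔻.prod ν), est z ∈ H ∧
        ∑ k, negLogLik ν (greedyObs ν θ₀ a (z k)) (est z)
          ≤ ∑ k, negLogLik ν (greedyObs ν θ₀ a (z k)) θ₀) →
      ∫ z, ∫ y, (inner ℝ y.1 (est z - θ₀)) ^ 2 ∂(𝔻.prod ν)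
        ∂(Measure.pi fun _ : Fin n => 𝔻.prod ν) ≤ C * (d / n) := by
  obtain ⟨L, c, hL, hc, hLc⟩ := exists_negLogLik_bounds hν hB
  -- `integral_erm_le` asks for curvature twice its parameter, so it is applied with c / 2.
  refine ⟨(L + c / 2 * B) ^ 2 / (c / 2) ^ 2, by positivity, ?_⟩
  intro d n R₁ R₂ H D hn hR₂ hH hD hHD θ₀ hθ₀ a ha 𝔻 _ h𝔻 est hest
  set h : Vec d → Vec d × ℝ → ℝ := fun θ z =>
    negLogLik ν (greedyObs ν θ₀ a z) θ - negLogLik ν (greedyObs ν θ₀ a z) θ₀ with hh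
  have hhm : ∀ θ, Measurable (h θ) := fun θ =>
    ((measurable_negLogLik θ).comp (measurable_greedyObs hν θ₀ a)).sub
      ((measurable_negLogLik θ₀).comp (measurable_greedyObs hν θ₀ a))
  have hTB : TotallyBounded H :=
    (isCompact_closedBall (0 : Vec d) R₁).totallyBounded.subset
      fun θ hθ => by simpa using hH θ hθ
  have hD' : ∀ᵐ z ∂(𝔻.prod ν), z.1 ∈ D := Measure.quasiMeasurePreserving_fst.ae h𝔻
  have hprice : ∀ x ∈ D, 0 ≤ greedyPrice ν (inner ℝ x a) ∧
      greedyPrice ν (inner ℝ x a) ≤ greedyPrice ν 0 + B := fun x hx =>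
    hν.greedyPrice_mem_Icc (hHD x hx a ha).1 (hHD x hx a ha).2
  have hlip : ∀ z : Vec d × ℝ, z.1 ∈ D → ∀ θ ∈ H, ∀ θ' ∈ H,
      |negLogLik ν (greedyObs ν θ₀ a z) θ - negLogLik ν (greedyObs ν θ₀ a z) θ'|
        ≤ L * |inner ℝ z.1 (θ - θ')| := fun z hz θ hθ θ' hθ' =>
    (hLc d z.1 θ θ' _ (hprice _ hz).1 (hprice _ hz).2 (hHD _ hz θ hθ).1 (hHD _ hz θ hθ).2
      (hHD _ hz θ' hθ').1 (hHD _ hz θ' hθ').2).1 _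
  have hinB : ∀ x ∈ D, ∀ θ ∈ H, |inner ℝ x (θ - θ₀)| ≤ B := by
    intro x hx θ hθ
    rw [inner_sub_right]
    have h1 := hHD x hx θ hθ
    have h2 := hHD x hx θ₀ hθ₀
    exact abs_le.2 ⟨by linarith, by linarith⟩
  have key := integral_erm_le hn (μ := 𝔻.prod ν) (X := Prod.fst) measurable_fst hTB θ₀ hhm hL hB
    hR₂ (half_pos hc) ?_ ?_ (est := est) ?_
  · refine key.trans_eq ?_
    field_simp
  · filter_upwards [hD'] with z hz
    refine ⟨hD _ hz, fun θ hθ => hlip z hz θ hθ θ₀ hθ₀, hinB _ hz, fun θ hθ θ' hθ' => ?_⟩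
    simp only [hh, sub_sub_sub_cancel_right]
    exact hlip z hz θ hθ θ' hθ'
  · intro θ hθ
    have hi1 : Integrable (h θ) (𝔻.prod ν) := by
      refine Integrable.of_bound (hhm θ).aestronglyMeasurable (L * B) ?_
      filter_upwards [hD'] with z hz
      exact (hlip z hz θ hθ θ₀ hθ₀).trans (mul_le_mul_of_nonneg_left (hinB _ hz θ hθ) hL)
    have hi2 : Integrable (fun x : Vec d => c * (inner ℝ x (θ - θ₀)) ^ 2) 𝔻 := by
      refine Integrable.const_mul (Integrable.of_bound
        ((measurable_id.inner measurable_const).pow_const 2).aestronglyMeasurable (B ^ 2) ?_) c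
      filter_upwards [h𝔻] with x hx
      rw [Real.norm_eq_abs, abs_of_nonneg (sq_nonneg _)]
      exact sq_le_sq.2 ((hinB x hx θ hθ).trans (le_abs_self B))
    have e1 : 2 * (c / 2) * ∫ z : Vec d × ℝ, (inner ℝ z.1 (θ - θ₀)) ^ 2 ∂(𝔻.prod ν)
        = ∫ x, c * (inner ℝ x (θ - θ₀)) ^ 2 ∂𝔻 := by
      rw [integral_const_mul, integral_fun_fst (fun x : Vec d => (inner ℝ x (θ - θ₀)) ^ 2),
        mul_div_cancel₀ c two_ne_zero]
      simp
    rw [e1, integral_prod _ hi1]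
    refine integral_mono_ae hi2 hi1.integral_prod_left ?_
    filter_upwards [h𝔻] with x hx
    exact (hLc d x θ θ₀ _ (hprice _ hx).1 (hprice _ hx).2 (hHD _ hx θ hθ).1 (hHD _ hx θ hθ).2
      (hHD _ hx θ₀ hθ₀).1 (hHD _ hx θ₀ hθ₀).2).2
  · filter_upwards [hest] with z hz
    refine ⟨hz.1, ?_⟩
    simp only [hh, Finset.sum_sub_distrib]
    linarith [hz.2]

/-! ### Transcripts of a pricing policy -/

section Transcript

variable {S : Type*} {d : ℕ}

theorem transcript_apply (A : Policy S d) (θ : Vec d) (s : S) (x : ℕ → Vec d) (N : ℕ → ℝ) :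
    ∀ (t : ℕ) (i : Fin t), transcript A θ s x N t i
      = (x i, A i s (x i) (transcript A θ s x N i),
        decide (A i s (x i) (transcript A θ s x N i) ≤ inner ℝ (x i) θ + N i))
  | t + 1, i => by
    induction i using Fin.lastCases with
    | last => simp [transcript]
    | cast i =>
      rw [transcript]
      simp only [Fin.snoc_castSucc, Fin.val_castSucc]
      exact transcript_apply A θ s x N t i

theorem transcript_congr (A : Policy S d) (θ : Vec d) (s : S) {x x' : ℕ → Vec d}
    {N N' : ℕ → ℝ} : ∀ t : ℕ, (∀ i < t, x i = x' i) → (∀ i < t, N i = N' i) →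
      transcript A θ s x N t = transcript A θ s x' N' t
  | 0, _, _ => rfl
  | t + 1, hx, hN => by
    rw [transcript, transcript, transcript_congr A θ s t (fun i hi => hx i (hi.trans t.lt_succ_self))
      fun i hi => hN i (hi.trans t.lt_succ_self), hx t t.lt_succ_self, hN t t.lt_succ_self]

theorem measurable_transcript [MeasurableSpace S] {A : Policy S d}
    (hA : ∀ t, Measurable fun p : S × Vec d × (Fin t → Obs d) => A t p.1 p.2.1 p.2.2)
    (θ : Vec d) : ∀ t : ℕ, Measurable fun p : S × (ℕ → Vec d × ℝ) =>
      transcript A θ p.1 (fun i => (p.2 i).1) (fun i => (p.2 i).2) t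
  | 0 => measurable_pi_lambda _ fun i => i.elim0
  | t + 1 => by
    have ih := measurable_transcript hA θ t
    have hz : Measurable fun p : S × (ℕ → Vec d × ℝ) => p.2 t :=
      (measurable_pi_apply t).comp measurable_snd
    have hv : Measurable fun p : S × (ℕ → Vec d × ℝ) => A t p.1 (p.2 t).1
        (transcript A θ p.1 (fun i => (p.2 i).1) (fun i => (p.2 i).2) t) :=
      (hA t).comp (measurable_fst.prodMk (hz.fst.prodMk ih))
    refine measurable_pi_lambda _ fun i => ?_
    induction i using Fin.lastCases with
    | last =>
      simp only [transcript, Fin.snoc_last]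
      refine hz.fst.prodMk (hv.prodMk (measurable_to_bool ?_))
      convert measurableSet_le hv ((hz.fst.inner (measurable_const (a := θ))).add hz.snd) using 1
      · ext p; simp
    | cast i =>
      simp only [transcript, Fin.snoc_castSucc]
      exact (measurable_pi_apply i).comp ih

theorem measurable_emlp [MeasurableSpace S] {ν : Measure ℝ} (hν : IsAdmissibleNoise ν)
    {init : S → Vec d → ℝ} (hinit : Measurable fun p : S × Vec d => init p.1 p.2)
    {est : (e : ℕ) → S → (Fin (2 ^ e) → Obs d) → Vec d}
    (hest : ∀ e, Measurable fun p : S × (Fin (2 ^ e) → Obs d) => est e p.1 p.2) (t : ℕ) :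
    Measurable fun p : S × Vec d × (Fin t → Obs d) => emlp ν init est t p.1 p.2.1 p.2.2 := by
  unfold emlp
  by_cases ht : t = 0
  · simp only [ht, dif_pos]
    exact hinit.comp (measurable_fst.prodMk measurable_snd.fst)
  · simp only [ht, dif_neg, not_false_eq_true]
    refine hν.measurable_greedyPrice.comp (measurable_snd.fst.inner
      ((hest (Nat.log 2 t)).comp (measurable_fst.prodMk (measurable_pi_lambda _ fun i => ?_))))
    exact (measurable_pi_apply _).comp measurable_snd.snd

theorem emlp_transcript (ν : Measure ℝ) (init : S → Vec d → ℝ)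
    (est : (e : ℕ) → S → (Fin (2 ^ e) → Obs d) → Vec d) (A : Policy S d) (θ : Vec d) (s : S)
    (x : ℕ → Vec d) (N : ℕ → ℝ) {t : ℕ} (ht : t ≠ 0) (y : Vec d) :
    emlp ν init est t s y (transcript A θ s x N t)
      = greedyPrice ν (inner ℝ y (est (Nat.log 2 t) s (transcript A θ s x N (2 ^ Nat.log 2 t)))) := by
  have h : (fun i => transcript A θ s x N t (Fin.castLE (Nat.pow_log_le_self 2 ht) i))
      = transcript A θ s x N (2 ^ Nat.log 2 t) := by
    funext i
    rw [transcript_apply, transcript_apply]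
    rfl
  simp only [emlp, ht, dif_neg, not_false_eq_true, h]

theorem sum_block_succ (k : ℕ) (f : ℕ → ℝ) :
    ∑ i ∈ block (k + 1), f i = ∑ j : Fin (2 ^ k), f (2 ^ k + j) := by
  have e : 2 ^ (k + 1) / 2 = 2 ^ k := by rw [pow_succ]; simp
  have h : (Finset.range (2 ^ (k + 1))).filter (fun i => 2 ^ k ≤ i)
      = Finset.Ico (2 ^ k) (2 ^ (k + 1)) := by
    ext i
    simp [and_comm]
  rw [block, Finset.sum_filter, e,
    Fin.sum_univ_eq_sum_range (fun i => if 2 ^ k ≤ i then f i else 0), ← Finset.sum_filter, h,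
    Finset.sum_Ico_eq_sum_range, Fin.sum_univ_eq_sum_range (fun j => f (2 ^ k + j))]
  congr 2
  rw [pow_succ]
  omega

end Transcript

/-! ### Independence of past, epoch and later rounds -/

section Independence

variable {Ω : Type*} [MeasurableSpace Ω] {P : Measure Ω} [IsProbabilityMeasure P]

/-- Both hypotheses together make the joint law of (f, g, h) a triple product; reassociating it
gives the claim. It serves to join the seed to the past rounds. -/
theorem indepFun_prodMk_left {α β γ : Type*} [MeasurableSpace α] [MeasurableSpace β]
    [MeasurableSpace γ] {f : Ω → α} {g : Ω → β} {h : Ω → γ} (hf : Measurable f)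
    (hg : Measurable g) (hh : Measurable h) (hfgh : IndepFun f (fun ω => (g ω, h ω)) P)
    (hgh : IndepFun g h P) : IndepFun (fun ω => (f ω, g ω)) h P := by
  have := Measure.isProbabilityMeasure_map (μ := P) hf.aemeasurable
  have := Measure.isProbabilityMeasure_map (μ := P) hg.aemeasurable
  have := Measure.isProbabilityMeasure_map (μ := P) hh.aemeasurable
  have hfg : IndepFun f g P := hfgh.comp (φ := id) (ψ := Prod.fst) measurable_id measurable_fst
  rw [indepFun_iff_map_prod_eq_prod_map_map (hf.prodMk hg).aemeasurable hh.aemeasurable,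
    hfg.map_prod_eq_prod_map_map hf.aemeasurable hg.aemeasurable]
  have h1 := hfgh.map_prod_eq_prod_map_map hf.aemeasurable (hg.prodMk hh).aemeasurable
  rw [hgh.map_prod_eq_prod_map_map hg.aemeasurable hh.aemeasurable,
    ← Measure.prodAssoc_prod] at h1
  apply MeasurableEquiv.prodAssoc.map_measurableEquiv_injective
  rw [← h1, Measure.map_map MeasurableEquiv.prodAssoc.measurable ((hf.prodMk hg).prodMk hh)]
  rfl

variable {E S : Type*} [MeasurableSpace E] [MeasurableSpace S] {Z : ℕ → Ω → E} {ξ : Ω → S}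

/-- The seed and the first `m` variables are independent of the later ones. -/
theorem indepFun_past_future (hZ : ∀ i, Measurable (Z i)) (hξ : Measurable ξ)
    (hind : iIndepFun Z P) (hseed : IndepFun ξ (fun ω i => Z i ω) P) (m : ℕ) {l : ℕ}
    (σ : Fin l → ℕ) (hσ : ∀ j, m ≤ σ j) :
    IndepFun (fun ω => (ξ ω, fun i : Fin m => Z i ω)) (fun ω j => Z (σ j) ω) P := by
  have hm : Measurable fun ω => fun i : Fin m => Z i ω := measurable_pi_lambda _ fun i => hZ i
  have hl : Measurable fun ω => fun j => Z (σ j) ω := measurable_pi_lambda _ fun j => hZ (σ j)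
  refine indepFun_prodMk_left hξ hm hl ?_ ?_
  · exact hseed.comp (φ := id)
      (ψ := fun z : ℕ → E => ((fun i : Fin m => z i), fun j => z (σ j))) measurable_id
      ((measurable_pi_lambda _ fun i => measurable_pi_apply _).prodMk
        (measurable_pi_lambda _ fun j => measurable_pi_apply _))
  · have hdisj : Disjoint (Finset.range m) (Finset.univ.image σ) := by
      rw [Finset.disjoint_left]
      intro i hi hi'
      obtain ⟨j, -, rfl⟩ := Finset.mem_image.1 hi'
      exact absurd (Finset.mem_range.1 hi) (not_lt.2 (hσ j))
    have h := hind.indepFun_finset _ _ hdisj hZ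
    exact h.comp
      (φ := fun z : Finset.range m → E => fun i : Fin m => z ⟨i, Finset.mem_range.2 i.2⟩)
      (ψ := fun z : Finset.univ.image σ → E =>
        fun j => z ⟨σ j, Finset.mem_image_of_mem σ (Finset.mem_univ j)⟩)
      (measurable_pi_lambda _ fun i => measurable_pi_apply _)
      (measurable_pi_lambda _ fun j => measurable_pi_apply _)

/-- Joint law of the past, the current block, and a later variable. -/
theorem map_past_block_fresh {μ : Measure E} [IsProbabilityMeasure μ] (hZ : ∀ i, Measurable (Z i))
    (hξ : Measurable ξ) (hlaw : ∀ i, P.map (Z i) = μ) (hind : iIndepFun Z P)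
    (hseed : IndepFun ξ (fun ω i => Z i ω) P) (n t : ℕ) (ht : n + n ≤ t) :
    P.map (fun ω => (((ξ ω, fun i : Fin n => Z i ω), fun j : Fin n => Z (n + j) ω), Z t ω))
      = ((P.map fun ω => (ξ ω, fun i : Fin n => Z i ω)).prod (Measure.pi fun _ => μ)).prod μ := by
  have hp : ∀ m, Measurable fun ω => (ξ ω, fun i : Fin m => Z i ω) := fun m =>
    hξ.prodMk (measurable_pi_lambda _ fun i => hZ i)
  have hb : Measurable fun ω => fun j : Fin n => Z (n + j) ω :=
    measurable_pi_lambda _ fun j => hZ _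
  have h1 := indepFun_past_future hZ hξ hind hseed n (fun j : Fin n => n + j) fun j => by omega
  -- For the later variable, the block is counted as part of a past of length n + n, which is then
  -- split in two.
  have h2 := indepFun_past_future hZ hξ hind hseed (n + n) (fun _ : Fin 1 => t) fun _ => ht
  have h3 : IndepFun (fun ω => ((ξ ω, fun i : Fin n => Z i ω), fun j : Fin n => Z (n + j) ω))
      (Z t) P :=
    h2.comp
      (φ := fun p : S × (Fin (n + n) → E) =>
        ((p.1, fun i : Fin n => p.2 (Fin.castAdd n i)), fun j : Fin n => p.2 (Fin.natAdd n j)))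
      (ψ := fun z : Fin 1 → E => z 0)
      ((measurable_fst.prodMk (measurable_pi_lambda _ fun i =>
        (measurable_pi_apply _).comp measurable_snd)).prodMk
        (measurable_pi_lambda _ fun i => (measurable_pi_apply _).comp measurable_snd))
      (measurable_pi_apply 0)
  rw [h3.map_prod_eq_prod_map_map ((hp n).prodMk hb).aemeasurable (hZ t).aemeasurable,
    h1.map_prod_eq_prod_map_map (hp n).aemeasurable hb.aemeasurable, hlaw]
  have h4 : iIndepFun (fun j : Fin n => Z (n + j)) P :=
    hind.precomp (g := fun j : Fin n => n + (j : ℕ)) fun i j hij => by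
      have : n + (i : ℕ) = n + j := hij
      exact Fin.ext (by omega)
  have h5 := h4.map_fun_eq_pi_map fun j => (hZ _).aemeasurable
  simp only [hlaw] at h5
  rw [h5]

end Independence

/-- Concatenation of two blocks of length `n`, continued by zero. -/
def glue {E : Type*} [Zero E] {n : ℕ} (p b : Fin n → E) (i : ℕ) : E :=
  if h : i < n then p ⟨i, h⟩ else if h : i - n < n then b ⟨i - n, h⟩ else 0

theorem glue_of_lt {E : Type*} [Zero E] {n : ℕ} (p b : Fin n → E) {i : ℕ} (h : i < n) :
    glue p b i = p ⟨i, h⟩ := by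
  simp [glue, h]

theorem glue_add {E : Type*} [Zero E] {n : ℕ} (p b : Fin n → E) (j : Fin n) :
    glue p b (n + j) = b j := by
  simp [glue]

theorem glue_restrict {E : Type*} [Zero E] {n : ℕ} (z : ℕ → E) {i : ℕ} (h : i < n + n) :
    glue (fun i : Fin n => z i) (fun j : Fin n => z (n + j)) i = z i := by
  rcases lt_or_ge i n with h1 | h1
  · exact glue_of_lt _ _ h1
  · obtain ⟨j, rfl⟩ := Nat.exists_eq_add_of_le h1
    exact glue_add _ _ (⟨j, by omega⟩ : Fin n)

theorem measurable_glue {E : Type*} [Zero E] [MeasurableSpace E] {n : ℕ} :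
    Measurable fun q : (Fin n → E) × (Fin n → E) => glue q.1 q.2 := by
  refine measurable_pi_lambda _ fun i => ?_
  unfold glue
  split_ifs with h1 h2
  · exact (measurable_pi_apply _).comp measurable_fst
  · exact (measurable_pi_apply _).comp measurable_snd
  · exact measurable_const

/-! ### Estimation error of one epoch -/

section Epoch

variable {S : Type*} {d : ℕ}

/-- All rounds of epoch k use the same estimate, computed before the epoch. With the past frozen,
the loss is therefore an empirical mean of i.i.d. terms, to which `exists_maxLikelihood_rate`
applies. -/
theorem empLoss_transcript_emlp (ν : Measure ℝ) (init : S → Vec d → ℝ)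
    (est : (e : ℕ) → S → (Fin (2 ^ e) → Obs d) → Vec d) (θ₀ : Vec d) (s : S)
    (z : ℕ → Vec d × ℝ) (k : ℕ) (θ : Vec d) :
    empLoss ν (k + 1) (transcript (emlp ν init est) θ₀ s (fun i => (z i).1) (fun i => (z i).2)
        (2 ^ (k + 1))) θ
      = ((2 ^ k : ℕ) : ℝ)⁻¹ * ∑ j : Fin (2 ^ k), negLogLik ν (greedyObs ν θ₀
          (est k s (transcript (emlp ν init est) θ₀ s (fun i => (z i).1) (fun i => (z i).2)
            (2 ^ k))) (z (2 ^ k + j))) θ := by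
  have hcard : ((block (k + 1)).card : ℝ) = ((2 ^ k : ℕ) : ℝ) := by
    have := sum_block_succ k fun _ => 1
    simpa using this
  rw [empLoss, hcard]
  congr 1
  simp only [transcript_apply]
  rw [sum_block_succ k fun i => negLogLik ν ((z i).1, emlp ν init est i s (z i).1
    (transcript (emlp ν init est) θ₀ s (fun i => (z i).1) (fun i => (z i).2) i),
    decide (emlp ν init est i s (z i).1 (transcript (emlp ν init est) θ₀ s (fun i => (z i).1)
      (fun i => (z i).2) i) ≤ inner ℝ (z i).1 θ₀ + (z i).2)) θ]
  refine Finset.sum_congr rfl fun j _ => ?_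
  have h0 : 2 ^ k + (j : ℕ) ≠ 0 := by positivity
  have hlog : Nat.log 2 (2 ^ k + (j : ℕ)) = k :=
    Nat.log_eq_of_pow_le_of_lt_pow (Nat.le_add_right _ _) (by
      have := j.2
      rw [pow_succ]
      omega)
  rw [emlp_transcript ν init est _ θ₀ s _ _ h0, hlog]
  rfl

variable [MeasurableSpace S]

theorem IsMaxLikelihood.est_transcript_mem {ν : Measure ℝ} {H D : Set (Vec d)}
    {est : (e : ℕ) → S → (Fin (2 ^ e) → Obs d) → Vec d} (hest : IsMaxLikelihood ν H D est)
    (A : Policy S d) (θ₀ : Vec d) (s : S) {x : ℕ → Vec d} (N : ℕ → ℝ) {e : ℕ}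
    (hx : ∀ i < 2 ^ e, x i ∈ D) : est e s (transcript A θ₀ s x N (2 ^ e)) ∈ H :=
  hest.mem e s _ fun i => by rw [transcript_apply]; exact hx i i.2

variable {Ω : Type*} [MeasurableSpace Ω] {P : Measure Ω}
  {ν : Measure ℝ} {𝔻 : Measure (Vec d)} {x : ℕ → Ω → Vec d} {N : ℕ → Ω → ℝ} {ξ : Ω → S}

theorem IsEnvironment.isProbabilityMeasure [IsProbabilityMeasure P]
    (h : IsEnvironment P 𝔻 ν x N ξ) :
    IsProbabilityMeasure 𝔻 := by
  rw [← h.law_feature 0]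
  exact Measure.isProbabilityMeasure_map (h.measurable_feature 0).aemeasurable

theorem IsEnvironment.ae_mem (h : IsEnvironment P 𝔻 ν x N ξ) {D : Set (Vec d)}
    (hD : ∀ᵐ z ∂𝔻, z ∈ D) : ∀ᵐ ω ∂P, ∀ i, x i ω ∈ D := by
  refine ae_all_iff.2 fun i => ae_of_ae_map (h.measurable_feature i).aemeasurable ?_
  rwa [h.law_feature i]

theorem IsEnvironment.map_round [IsProbabilityMeasure P] [IsProbabilityMeasure ν]
    (h : IsEnvironment P 𝔻 ν x N ξ) (i : ℕ) :
    P.map (fun ω => (x i ω, N i ω)) = 𝔻.prod ν := by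
  rw [(h.indep_noise i).map_prod_eq_prod_map_map (h.measurable_feature i).aemeasurable
    (h.measurable_noise i).aemeasurable, h.law_feature, h.law_noise]

theorem IsEnvironment.measurable_rounds (h : IsEnvironment P 𝔻 ν x N ξ) :
    Measurable fun ω => (ξ ω, fun i => (x i ω, N i ω)) :=
  h.measurable_seed.prodMk (measurable_pi_lambda _ fun i =>
    (h.measurable_feature i).prodMk (h.measurable_noise i))

theorem IsEnvironment.measurable_est (hν : IsAdmissibleNoise ν)
    (h : IsEnvironment P 𝔻 ν x N ξ) {init : S → Vec d → ℝ}
    (hinit : Measurable fun p : S × Vec d => init p.1 p.2) {H D : Set (Vec d)}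
    {est : (e : ℕ) → S → (Fin (2 ^ e) → Obs d) → Vec d} (hest : IsMaxLikelihood ν H D est)
    (θ₀ : Vec d) (e : ℕ) :
    Measurable fun ω => est e (ξ ω) (transcript (emlp ν init est) θ₀ (ξ ω) (fun i => x i ω)
      (fun i => N i ω) (2 ^ e)) :=
  (hest.measurable e).comp (h.measurable_seed.prodMk
    ((measurable_transcript (measurable_emlp hν hinit hest.measurable) θ₀ (2 ^ e)).comp
      h.measurable_rounds))

/-- The estimate computed from epoch `k` has expected squared prediction error `O(d / 2 ^ k)` at
later rounds. -/
theorem exists_estimation_rate [IsProbabilityMeasure ν] (hν : IsAdmissibleNoise ν) {B : ℝ}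
    (hB : 0 ≤ B) :
    ∃ C : ℝ, 0 ≤ C ∧ ∀ (d : ℕ) (R₁ R₂ : ℝ) (H D : Set (Vec d)), 0 ≤ R₂ →
      (∀ θ ∈ H, ‖θ‖ ≤ R₁) → (∀ z ∈ D, ‖z‖ ≤ R₂) →
      (∀ z ∈ D, ∀ θ ∈ H, 0 ≤ inner ℝ z θ ∧ inner ℝ z θ ≤ B) →
      ∀ θ₀ ∈ H, ∀ (𝔻 : Measure (Vec d)), (∀ᵐ z ∂𝔻, z ∈ D) →
      ∀ (Ω : Type*) [MeasurableSpace Ω] (S : Type*) [MeasurableSpace S] (P : Measure Ω)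
        [IsProbabilityMeasure P] (x : ℕ → Ω → Vec d) (N : ℕ → Ω → ℝ) (ξ : Ω → S),
        IsEnvironment P 𝔻 ν x N ξ →
      ∀ (init : S → Vec d → ℝ), (Measurable fun p : S × Vec d => init p.1 p.2) →
      ∀ (est : (e : ℕ) → S → (Fin (2 ^ e) → Obs d) → Vec d), IsMaxLikelihood ν H D est →
      ∀ k t : ℕ, 2 ^ (k + 1) ≤ t →
        ∫ ω, (inner ℝ (x t ω) (est (k + 1) (ξ ω) (transcript (emlp ν init est) θ₀ (ξ ω)
          (fun i => x i ω) (fun i => N i ω) (2 ^ (k + 1))) - θ₀)) ^ 2 ∂P ≤ C * (d / 2 ^ k) := by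
  obtain ⟨C, hC, hrate⟩ := exists_maxLikelihood_rate hν hB
  refine ⟨C, hC, ?_⟩
  intro d R₁ R₂ H D hR₂ hH hD hHD θ₀ hθ₀ 𝔻 h𝔻 Ω _ S _ P _ x N ξ henv init hinit est hest k t ht
  have := henv.isProbabilityMeasure
  set n := 2 ^ k with hn
  have hnn : 2 ^ (k + 1) = n + n := by rw [pow_succ, hn]; ring
  have hn0 : 0 < n := by positivity
  set A := emlp ν init est with hA
  set Z : ℕ → Ω → Vec d × ℝ := fun i ω => (x i ω, N i ω) with hZ
  have hZm : ∀ i, Measurable (Z i) := fun i =>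
    (henv.measurable_feature i).prodMk (henv.measurable_noise i)
  set tr : S → (ℕ → Vec d × ℝ) → (m : ℕ) → (Fin m → Obs d) :=
    fun s z m => transcript A θ₀ s (fun i => (z i).1) (fun i => (z i).2) m with htr
  have htrm : ∀ m, Measurable fun p : S × (ℕ → Vec d × ℝ) => tr p.1 p.2 m := fun m =>
    measurable_transcript (measurable_emlp hν hinit hest.measurable) θ₀ m
  -- The new estimate as a function of seed, past and current block only. `glue` pads these 2n
  -- rounds to an infinite sequence, whose tail the transcript never reads.
  set Φ : (S × (Fin n → Vec d × ℝ)) × (Fin n → Vec d × ℝ) → Vec d :=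
    fun q => est (k + 1) q.1.1 (tr q.1.1 (glue q.1.2 q.2) (2 ^ (k + 1))) with hΦ
  have hΦm : Measurable Φ :=
    (hest.measurable (k + 1)).comp (measurable_fst.fst.prodMk ((htrm _).comp
      (measurable_fst.fst.prodMk (measurable_glue.comp
        (measurable_fst.snd.prodMk measurable_snd)))))
  set f : Ω → ((S × (Fin n → Vec d × ℝ)) × (Fin n → Vec d × ℝ)) × (Vec d × ℝ) :=
    fun ω => (((ξ ω, fun i : Fin n => Z i ω), fun j : Fin n => Z (n + j) ω), Z t ω) with hf
  have hpm : Measurable fun ω => (ξ ω, fun i : Fin n => Z i ω) :=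
    henv.measurable_seed.prodMk (measurable_pi_lambda _ fun i => hZm i)
  have hfm : Measurable f :=
    (hpm.prodMk (measurable_pi_lambda _ fun j => hZm _)).prodMk (hZm t)
  have hΦf : ∀ ω, Φ (f ω).1 = est (k + 1) (ξ ω) (transcript A θ₀ (ξ ω) (fun i => x i ω)
      (fun i => N i ω) (2 ^ (k + 1))) := by
    intro ω
    have hg : ∀ i < 2 ^ (k + 1),
        glue (fun i : Fin n => Z i ω) (fun j : Fin n => Z (n + j) ω) i = Z i ω := fun i hi =>
      glue_restrict (fun i => Z i ω) (hnn ▸ hi)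
    simp only [hΦ, hf, htr]
    rw [transcript_congr A θ₀ (ξ ω) (2 ^ (k + 1)) (fun i hi => congrArg Prod.fst (hg i hi))
      fun i hi => congrArg Prod.snd (hg i hi)]
  set Ψ : ((S × (Fin n → Vec d × ℝ)) × (Fin n → Vec d × ℝ)) × (Vec d × ℝ) → ℝ :=
    fun q => (inner ℝ q.2.1 (Φ q.1 - θ₀)) ^ 2 with hΨ
  have hΨm : Measurable Ψ :=
    (measurable_snd.fst.inner ((hΦm.comp measurable_fst).sub measurable_const)).pow_const 2
  have hlaw := map_past_block_fresh hZm henv.measurable_seed (fun i => henv.map_round i)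
    henv.indep_rounds henv.indep_seed n t (hnn ▸ ht)
  have hΨi : Integrable Ψ (P.map f) := by
    rw [integrable_map_measure hΨm.aestronglyMeasurable hfm.aemeasurable]
    refine Integrable.of_bound (hΨm.comp hfm).aestronglyMeasurable (B ^ 2) ?_
    filter_upwards [henv.ae_mem h𝔻] with ω hω
    rw [Real.norm_eq_abs, abs_of_nonneg (sq_nonneg _)]
    refine sq_le_sq.2 (le_trans ?_ (le_abs_self B))
    have h1 : Φ (f ω).1 ∈ H := by
      rw [hΦf]
      exact hest.est_transcript_mem A θ₀ (ξ ω) _ fun i _ => hω i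
    have h2 := hHD _ (hω t) _ h1
    have h3 := hHD _ (hω t) _ hθ₀
    change |inner ℝ (x t ω) (Φ (f ω).1 - θ₀)| ≤ B
    rw [inner_sub_right]
    exact abs_le.2 ⟨by linarith, by linarith⟩
  have e1 : ∫ ω, (inner ℝ (x t ω) (est (k + 1) (ξ ω) (transcript A θ₀ (ξ ω)
          (fun i => x i ω) (fun i => N i ω) (2 ^ (k + 1))) - θ₀)) ^ 2 ∂P
      = ∫ q, Ψ q ∂(P.map f) := by
    rw [integral_map hfm.aemeasurable hΨm.aestronglyMeasurable]
    refine integral_congr_ae (Filter.Eventually.of_forall fun ω => ?_)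
    simp only [hΨ, hΦf]
    rfl
  rw [e1]
  have hρ : IsProbabilityMeasure (P.map fun ω => (ξ ω, fun i : Fin n => Z i ω)) :=
    Measure.isProbabilityMeasure_map hpm.aemeasurable
  rw [hlaw] at hΨi ⊢
  -- Fubini replaces conditioning: for almost every fixed past p, the block and the later round are
  -- independent samples.
  rw [integral_prod _ hΨi, integral_prod _ hΨi.integral_prod_left]
  have hDμ : ∀ᵐ z ∂(𝔻.prod ν), z.1 ∈ D := Measure.quasiMeasurePreserving_fst.ae h𝔻
  have hpast : ∀ᵐ p ∂(P.map fun ω => (ξ ω, fun i : Fin n => Z i ω)), ∀ i, (p.2 i).1 ∈ D := by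
    refine ae_all_iff.2 fun i => ?_
    have hm : Measurable fun p : S × (Fin n → Vec d × ℝ) => (p.2 i).1 :=
      ((measurable_pi_apply i).comp measurable_snd).fst
    refine ae_of_ae_map hm.aemeasurable ?_
    rw [Measure.map_map hm hpm]
    change ∀ᵐ z ∂(P.map (x i)), z ∈ D
    rwa [henv.law_feature]
  have hfinal : ∀ᵐ p ∂(P.map fun ω => (ξ ω, fun i : Fin n => Z i ω)),
      ∫ b, ∫ y, Ψ ((p, b), y) ∂(𝔻.prod ν) ∂(Measure.pi fun _ : Fin n => 𝔻.prod ν)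
        ≤ C * (d / n) := by
    filter_upwards [hpast] with p hp
    -- The estimate in force during the block depends on the past alone; inserting the zero block
    -- exhibits it as one parameter for all b.
    have ha : est k p.1 (tr p.1 (glue p.2 0) (2 ^ k)) ∈ H :=
      hest.est_transcript_mem A θ₀ p.1 _ fun i hi => by
        rw [glue_of_lt _ _ hi]; exact hp _
    refine hrate d n R₁ R₂ H D hn0 hR₂ hH hD hHD θ₀ hθ₀ _ ha 𝔻 h𝔻 (fun b => Φ (p, b)) ?_
    filter_upwards [ae_pi_forall hDμ] with b hb
    have hxD : ∀ i < 2 ^ (k + 1), (glue p.2 b i).1 ∈ D := by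
      intro i hi
      rcases lt_or_ge i n with h1 | h1
      · rw [glue_of_lt _ _ h1]; exact hp _
      · obtain ⟨j, rfl⟩ := Nat.exists_eq_add_of_le h1
        have := glue_add p.2 b ⟨j, by omega⟩
        simp only at this
        rw [this]
        exact hb _
    have htreq : tr p.1 (glue p.2 b) (2 ^ k) = tr p.1 (glue p.2 0) (2 ^ k) :=
      transcript_congr A θ₀ p.1 _
        (fun i hi => by rw [glue_of_lt _ _ hi, glue_of_lt _ _ hi])
        (fun i hi => by rw [glue_of_lt _ _ hi, glue_of_lt _ _ hi])
    refine ⟨hest.est_transcript_mem A θ₀ p.1 _ hxD, ?_⟩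
    have hmin := hest.isMinOn (k + 1) p.1 (tr p.1 (glue p.2 b) (2 ^ (k + 1)))
      (fun i => by simp only [htr]; rw [transcript_apply]; exact hxD i i.2) hθ₀
    have hmin' : empLoss ν (k + 1) (tr p.1 (glue p.2 b) (2 ^ (k + 1))) (Φ (p, b))
        ≤ empLoss ν (k + 1) (tr p.1 (glue p.2 b) (2 ^ (k + 1))) θ₀ := hmin
    simp only [htr, hA] at hmin' htreq ⊢
    rw [empLoss_transcript_emlp, empLoss_transcript_emlp, htreq] at hmin'
    have hpos : (0 : ℝ) < ((2 ^ k : ℕ) : ℝ)⁻¹ := by positivity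
    have := le_of_mul_le_mul_left hmin' hpos
    simpa only [← hn, glue_add] using this
  calc _ ≤ ∫ _p, C * (d / n) ∂(P.map fun ω => (ξ ω, fun i : Fin n => Z i ω)) :=
        integral_mono_of_nonneg (Filter.Eventually.of_forall fun p =>
          integral_nonneg fun b => integral_nonneg fun y => sq_nonneg _)
          (integrable_const _) hfinal
    _ = C * (d / 2 ^ k) := by simp [hn]

end Epoch

/-! ### From estimation error to regret -/

theorem roundRegret_eq {S : Type*} {d : ℕ} {ν : Measure ℝ} (hν : IsAdmissibleNoise ν)
    (A : Policy S d) (θ : Vec d) (s : S) (x : ℕ → Vec d) (N : ℕ → ℝ) (t : ℕ) :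
    roundRegret ν A θ s x N t = expReward ν (greedyPrice ν (inner ℝ (x t) θ)) (inner ℝ (x t) θ)
      - expReward ν (A t s (x t) (transcript A θ s x N t)) (inner ℝ (x t) θ) := by
  rw [roundRegret, hν.iSup_expReward]

theorem roundRegret_nonneg {S : Type*} {d : ℕ} {ν : Measure ℝ} (hν : IsAdmissibleNoise ν)
    (A : Policy S d) (θ : Vec d) (s : S) (x : ℕ → Vec d) (N : ℕ → ℝ) (t : ℕ) :
    0 ≤ roundRegret ν A θ s x N t := by
  rw [roundRegret_eq hν]
  exact sub_nonneg.2 (hν.expReward_le_greedyPrice _ _)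

theorem measurable_roundRegret {S Ω : Type*} [MeasurableSpace S] [MeasurableSpace Ω]
    {P : Measure Ω} {d : ℕ} {ν : Measure ℝ} (hν : IsAdmissibleNoise ν)
    {𝔻 : Measure (Vec d)}
    {x : ℕ → Ω → Vec d} {N : ℕ → Ω → ℝ} {ξ : Ω → S} (henv : IsEnvironment P 𝔻 ν x N ξ)
    {A : Policy S d}
    (hA : ∀ t, Measurable fun p : S × Vec d × (Fin t → Obs d) => A t p.1 p.2.1 p.2.2)
    (θ : Vec d) (t : ℕ) :
    Measurable fun ω => roundRegret ν A θ (ξ ω) (fun i => x i ω) (fun i => N i ω) t := by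
  simp only [roundRegret_eq hν]
  have hu : Measurable fun ω => inner ℝ (x t ω) θ :=
    (henv.measurable_feature t).inner measurable_const
  have hv : Measurable fun ω => A t (ξ ω) (x t ω)
      (transcript A θ (ξ ω) (fun i => x i ω) (fun i => N i ω) t) :=
    (hA t).comp (henv.measurable_seed.prodMk ((henv.measurable_feature t).prodMk
      ((measurable_transcript hA θ t).comp henv.measurable_rounds)))
  exact (hν.measurable_expReward.comp ((hν.measurable_greedyPrice.comp hu).prodMk hu)).sub
    (hν.measurable_expReward.comp (hv.prodMk hu))

theorem integrable_integral_le {Ω : Type*} [MeasurableSpace Ω] {P : Measure Ω}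
    [IsProbabilityMeasure P] {f : Ω → ℝ} (hm : Measurable f) (h0 : ∀ ω, 0 ≤ f ω) {b : ℝ}
    (hb : ∀ᵐ ω ∂P, f ω ≤ b) : Integrable f P ∧ ∫ ω, f ω ∂P ≤ b := by
  have hi : Integrable f P := Integrable.of_bound hm.aestronglyMeasurable b (by
    filter_upwards [hb] with ω hω
    rwa [Real.norm_eq_abs, abs_of_nonneg (h0 ω)])
  refine ⟨hi, (integral_mono_ae hi (integrable_const b) hb).trans_eq (by simp)⟩

/-- Summing a rate `C d / 2 ^ ⌊log₂ t⌋` over `t ≤ T` costs a logarithm. -/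
theorem sum_epoch_rate_le {C G d : ℝ} (hC : 0 ≤ C) (hG : 0 ≤ G) (hd : 1 ≤ d) {r : ℕ → ℝ}
    (h0 : r 0 ≤ G) (hr : ∀ e t : ℕ, 2 ^ e ≤ t → t < 2 ^ (e + 1) → r t ≤ C * (d / 2 ^ e)) {T : ℕ}
    (hT : 2 ≤ T) :
    ∑ t ∈ Finset.range (T + 1), r t ≤ 2 * (3 * C + G) * d * Real.log T := by
  have hd0 : 0 ≤ d := zero_le_one.trans hd
  -- Round t + 1 lies in an epoch of length at least (t + 1)/2, so the epoch sums reduce to the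
  -- harmonic sum.
  have h1 : ∀ t ∈ Finset.range T, r (t + 1) ≤ 2 * C * d * ((t + 1 : ℕ) : ℝ)⁻¹ := by
    intro t _
    have ht : t + 1 ≠ 0 := t.succ_ne_zero
    have hlt : t + 1 < 2 ^ (Nat.log 2 (t + 1) + 1) := Nat.lt_pow_succ_log_self (by norm_num) _
    refine (hr (Nat.log 2 (t + 1)) (t + 1) (Nat.pow_log_le_self 2 ht) hlt).trans ?_
    have hlt' : ((t + 1 : ℕ) : ℝ) ≤ 2 ^ Nat.log 2 (t + 1) * 2 := by
      rw [← pow_succ]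
      exact_mod_cast hlt.le
    rw [← div_eq_mul_inv, mul_div_assoc', div_le_div_iff₀ (by positivity) (by positivity)]
    have : 0 ≤ C * d := mul_nonneg hC hd0
    nlinarith [mul_le_mul_of_nonneg_left hlt' this]
  have h2 : ∑ t ∈ Finset.range T, ((t + 1 : ℕ) : ℝ)⁻¹ ≤ 1 + Real.log T := by
    have := harmonic_le_one_add_log T
    simpa [harmonic] using this
  -- Since T ≥ 2, this absorbs additive constants: 1 + log T ≤ 3 log T and G ≤ 2 G d log T.
  have hlog : 1 / 2 ≤ Real.log T := by
    have e1 : Real.log 2 ≤ Real.log T := Real.log_le_log (by norm_num) (by exact_mod_cast hT)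
    linarith [Real.log_two_gt_d9]
  rw [Finset.sum_range_succ']
  have h3 : ∑ t ∈ Finset.range T, r (t + 1) ≤ 2 * C * d * (1 + Real.log T) := by
    refine (Finset.sum_le_sum h1).trans ?_
    rw [← Finset.mul_sum]
    exact mul_le_mul_of_nonneg_left h2 (by positivity)
  have h4 : 2 * C * d * (1 + Real.log T) ≤ 2 * C * d * (3 * Real.log T) :=
    mul_le_mul_of_nonneg_left (by linarith) (by positivity)
  have h5 : G * 1 ≤ G * (d * (2 * Real.log T)) := by
    refine mul_le_mul_of_nonneg_left ?_ hG
    nlinarith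
  linarith

end FeaturePricing

open FeaturePricing

theorem mainTheorem1 (ν : Measure ℝ) [IsProbabilityMeasure ν]
    (hν : FeaturePricing.IsAdmissibleNoise ν) (B : ℝ) :
    ∃ C_s : ℝ, ∀ (d : ℕ), 1 ≤ d → ∀ (B₁ B₂ : ℝ), B₁ * B₂ = B →
      ∀ (H D : Set (FeaturePricing.Vec d)),
        Convex ℝ H → (∀ θ ∈ H, ‖θ‖ ≤ B₁) → (∀ z ∈ D, ‖z‖ ≤ B₂) →
        (∀ z ∈ D, ∀ θ ∈ H, 0 ≤ inner ℝ z θ ∧ inner ℝ z θ ≤ B) →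
      ∀ θstar ∈ H,
      ∀ (𝔻 : Measure (FeaturePricing.Vec d)), (∀ᵐ z ∂𝔻, z ∈ D) →
      ∀ (Ω : Type*) [MeasurableSpace Ω] (S : Type*) [MeasurableSpace S]
        (P : Measure Ω) [IsProbabilityMeasure P]
        (x : ℕ → Ω → FeaturePricing.Vec d) (N : ℕ → Ω → ℝ) (ξ : Ω → S),
        FeaturePricing.IsEnvironment P 𝔻 ν x N ξ →
      ∀ (init : S → FeaturePricing.Vec d → ℝ),
        Measurable (fun p : S × FeaturePricing.Vec d => init p.1 p.2) →
        (∀ s z, 0 ≤ init s z) →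
      ∀ (est : (e : ℕ) → S → (Fin (2 ^ e) → FeaturePricing.Obs d) → FeaturePricing.Vec d),
        FeaturePricing.IsMaxLikelihood ν H D est →
      (∀ T : ℕ, 2 ≤ T →
        Integrable (fun ω => FeaturePricing.regret ν (FeaturePricing.emlp ν init est) θstar
          (ξ ω) (fun t => x t ω) (fun t => N t ω) T) P ∧
        ∫ ω, FeaturePricing.regret ν (FeaturePricing.emlp ν init est) θstar
          (ξ ω) (fun t => x t ω) (fun t => N t ω) T ∂P ≤ 2 * C_s * d * Real.log T) ∧
      (∀ e t : ℕ, 2 ^ e ≤ t → t < 2 ^ (e + 1) →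
        Integrable (fun ω => FeaturePricing.roundRegret ν (FeaturePricing.emlp ν init est) θstar
          (ξ ω) (fun t => x t ω) (fun t => N t ω) t) P ∧
        ∫ ω, FeaturePricing.roundRegret ν (FeaturePricing.emlp ν init est) θstar
          (ξ ω) (fun t => x t ω) (fun t => N t ω) t ∂P ≤ C_s * (d / 2 ^ e)) := by
  -- A negative B is vacuous: 𝔻 is a probability measure, so D has a point z, and 0 ≤ ⟨z, θ*⟩ ≤ B
  -- fails.
  rcases lt_or_ge B 0 with hB | hB
  · refine ⟨0, ?_⟩
    intro d _ B₁ B₂ _ H D _ _ _ hHD θ₀ hθ₀ 𝔻 h𝔻 Ω _ S _ P _ x N ξ henv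
    have := henv.isProbabilityMeasure
    obtain ⟨z, hz⟩ := h𝔻.exists
    have := hHD z hz θ₀ hθ₀
    exact absurd (this.1.trans this.2) (not_le.2 hB)
  obtain ⟨K, hK, hrate⟩ := exists_estimation_rate hν hB
  obtain ⟨Q, hQ, hquad⟩ := hν.exists_quadratic_regret B
  -- The first summand serves epoch 0, whose estimate comes from a single arbitrary price and may
  -- carry no information. The second serves epoch k + 1, whose estimate uses only 2^k rounds, half
  -- its length; hence the factor 2.
  set C := Q * B ^ 2 + 2 * (Q * K) with hC
  have hC0 : 0 ≤ C := by positivity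
  set G := greedyPrice ν 0 + B with hG
  have hG0 : 0 ≤ G := add_nonneg (hν.greedyPrice_pos 0).le hB
  refine ⟨3 * C + G, ?_⟩
  intro d hd B₁ B₂ hBB H D _ hH hD hHD θ₀ hθ₀ 𝔻 h𝔻 Ω _ S _ P _ x N ξ henv init hinit hinit0
    est hest
  have := henv.isProbabilityMeasure
  obtain ⟨z₀, hz₀⟩ := h𝔻.exists
  have hB₂ : 0 ≤ B₂ := (norm_nonneg _).trans (hD z₀ hz₀)
  have hd1 : (1 : ℝ) ≤ d := by exact_mod_cast hd
  have hmem := henv.ae_mem h𝔻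
  have hAm := measurable_emlp hν hinit hest.measurable
  set A := emlp ν init est with hA
  have hrm : ∀ t, Measurable fun ω => roundRegret ν A θ₀ (ξ ω) (fun i => x i ω)
      (fun i => N i ω) t := measurable_roundRegret hν henv hAm θ₀
  have hr0 : ∀ t ω, 0 ≤ roundRegret ν A θ₀ (ξ ω) (fun i => x i ω) (fun i => N i ω) t :=
    fun t ω => roundRegret_nonneg hν _ _ _ _ _ _
  -- A nonnegative price earns a nonnegative reward, so the regret of round 0 is at most the optimal
  -- reward, itself at most J(0) + B.
  have hinit_round := integrable_integral_le (b := G) (P := P) (hrm 0) (hr0 0) (by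
    filter_upwards [hmem] with ω hω
    have h1 := hHD _ (hω 0) _ hθ₀
    rw [roundRegret_eq hν]
    have h2 := hν.expReward_greedyPrice_le h1.1 h1.2
    have h3 : 0 ≤ A 0 (ξ ω) (x 0 ω) (transcript A θ₀ (ξ ω) (fun i => x i ω)
        (fun i => N i ω) 0) := by simpa [hA, emlp] using hinit0 _ _
    linarith [hν.expReward_nonneg h3 (inner ℝ (x 0 ω) θ₀)])
  have hround : ∀ e t : ℕ, 2 ^ e ≤ t → t < 2 ^ (e + 1) →
      Integrable (fun ω => roundRegret ν A θ₀ (ξ ω) (fun i => x i ω) (fun i => N i ω) t) P ∧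
      ∫ ω, roundRegret ν A θ₀ (ξ ω) (fun i => x i ω) (fun i => N i ω) t ∂P
        ≤ C * (d / 2 ^ e) := by
    intro e t het hte
    have ht0 : t ≠ 0 := by
      have : 0 < 2 ^ e := by positivity
      omega
    have hlog : Nat.log 2 t = e := Nat.log_eq_of_pow_le_of_lt_pow het hte
    set q : Ω → ℝ := fun ω => (inner ℝ (x t ω) (est e (ξ ω) (transcript A θ₀ (ξ ω)
      (fun i => x i ω) (fun i => N i ω) (2 ^ e)) - θ₀)) ^ 2 with hq
    have hle : ∀ᵐ ω ∂P, roundRegret ν A θ₀ (ξ ω) (fun i => x i ω) (fun i => N i ω) t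
        ≤ Q * q ω ∧ q ω ≤ B ^ 2 := by
      filter_upwards [hmem] with ω hω
      have hθ := hest.est_transcript_mem A θ₀ (ξ ω) (fun i => N i ω) (e := e) fun i _ => hω i
      have h1 := hHD _ (hω t) _ hθ₀
      have h2 := hHD _ (hω t) _ hθ
      constructor
      · rw [roundRegret_eq hν, hA, emlp_transcript ν init est _ _ _ _ _ ht0, hlog, ← hA]
        simp only [hq, inner_sub_right]
        exact hquad _ _ h1.1 h1.2 h2.1 h2.2
      · refine sq_le_sq.2 (le_trans ?_ (le_abs_self B))
        rw [inner_sub_right]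
        exact abs_le.2 ⟨by linarith, by linarith⟩
    have hqm : Measurable q := ((henv.measurable_feature t).inner
      ((henv.measurable_est hν hinit hest θ₀ e).sub measurable_const)).pow_const 2
    have hqi := integrable_integral_le (P := P) hqm (fun ω => sq_nonneg _)
      (hle.mono fun ω h => h.2)
    obtain ⟨hri, -⟩ := integrable_integral_le (P := P) (b := Q * B ^ 2) (hrm t) (hr0 t)
      (hle.mono fun ω h => h.1.trans (mul_le_mul_of_nonneg_left h.2 hQ))
    refine ⟨hri, ?_⟩
    have hint : ∫ ω, roundRegret ν A θ₀ (ξ ω) (fun i => x i ω) (fun i => N i ω) t ∂P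
        ≤ Q * ∫ ω, q ω ∂P := by
      rw [← integral_const_mul]
      exact integral_mono_ae hri (hqi.1.const_mul Q) (hle.mono fun ω h => h.1)
    refine hint.trans ?_
    rcases e with _ | k
    · have h1 := mul_le_mul_of_nonneg_left hqi.2 hQ
      have h2 : C ≤ C * (d / 2 ^ 0) := by
        rw [pow_zero, div_one]
        exact le_mul_of_one_le_right hC0 hd1
      have h3 : 0 ≤ Q * K := mul_nonneg hQ hK
      linarith
    · have h1 := mul_le_mul_of_nonneg_left (hrate d B₁ B₂ H D hB₂ hH hD hHD θ₀ hθ₀ 𝔻 h𝔻 Ω S P x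
        N ξ henv init hinit est hest k t het) hQ
      refine h1.trans ?_
      have h2 : Q * (K * (d / 2 ^ k)) = 2 * (Q * K) * (d / 2 ^ (k + 1)) := by
        rw [pow_succ]
        field_simp
      rw [h2]
      refine mul_le_mul_of_nonneg_right ?_ (by positivity)
      have : 0 ≤ Q * B ^ 2 := by positivity
      linarith
  have hint : ∀ t, Integrable (fun ω => roundRegret ν A θ₀ (ξ ω) (fun i => x i ω)
      (fun i => N i ω) t) P := by
    intro t
    rcases eq_or_ne t 0 with rfl | ht
    · exact hinit_round.1
    · exact (hround _ t (Nat.pow_log_le_self 2 ht)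
        (Nat.lt_pow_succ_log_self (by norm_num) _)).1
  refine ⟨fun T hT => ⟨integrable_finsetSum _ fun t _ => hint t, ?_⟩, fun e t het hte =>
    ⟨hint t, (hround e t het hte).2.trans (mul_le_mul_of_nonneg_right ?_ (by positivity))⟩⟩
  · simp only [regret]
    rw [integral_finsetSum _ fun t _ => hint t]
    exact sum_epoch_rate_le hC0 hG0 hd1 hinit_round.2
      (fun e t het hte => (hround e t het hte).2) hT
  · linarith
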